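/- Let $L>0$, $0<G_0\le G_1$ and $M\ge 0$, and let $A(M)$ be the set of $L$-periodic functions $G\in C^1(\mathbb R)$ with $G_0\le G\le G_1$ and $|G'|\le M$ on $\mathbb R$. For $G\in A(M)$ put $$Y^*(G)=\{(y_1,y_2)\in\mathbb R^2:\ 0<y_1<L,\ 0<y_2<G(y_1)\},\qquad B_1(G)=\{(s,G(s)):0<s<L\},$$ and let $H(G)$ be the space of all $V\in H^1(Y^*(G))$ with $V(0,\cdot)=V(L,\cdot)$ on $(0,G(0))$ in the sense of traces and $\int_{Y^*(G)}V=0$. Let $X(G)$ be the solution of the cell problem ($-\Delta X=0$ in $Y^*(G)$; $\partial X/\partial N=0$ on the lower boundary; $\partial X/\partial N=N_1=-G'/\sqrt{1+(G')^2}$ on $B_1(G)$; $X$ periodic in $y_1$; $\int_{Y^*(G)}X=0$), understood in the weak sense: $X(G)\in H(G)$ and $$\int_{Y^*(G)}\nabla X(G)\cdot\nabla V\,dy=-\int_{B_1(G)}\frac{G'}{\sqrt{1+(G')^2}}\,V\,d\mathcal S\qquad\text{for all }V\in H(G).$$ For $G,\hat G\in A(M)$ let $L_{\hat G}:Y^*(G)\to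 Y^*(\hat G)$, $L_{\hat G}(z_1,z_2)=\bigl(z_1,\tfrac{\hat G(z_1)}{G(z_1)}z_2\bigr)$, and, on $Y^*(G)$, $$U(\hat G)=X(\hat G)\circ L_{\hat G}-\frac1{|Y^*(G)|}\int_{Y^*(G)}X(\hat G)\circ L_{\hat G},$$ so that $U(G)=X(G)$. Put $$r(G)=\frac1{|Y^*(G)|}\int_{Y^*(G)}\Bigl\{1-\frac{\partial X(G)}{\partial y_1}\Bigr\}\,dy_1dy_2,\qquad \|f\|_{C^1(\mathbb R)}=\sup_{\mathbb R}|f|+\sup_{\mathbb R}|f'|.$$ Then, for every $G\in A(M)$, the cell problem has exactly one weak solution $X(G)$ (up to equality almost everywhere). Moreover, for each $\epsilon>0$ there exists $\delta>0$ (depending only on $\epsilon,L,G_0,G_1,M$) such that for all $G,\hat G\in A(M)$ with $\|G-\hat G\|_{C^1(\mathbb R)}\le\delta$, the functions $U(G)$ and $U(\hat G)$ belong to $H^1(Y^*(G))$ and $$\|U(G)-U(\hat G)\|_{H^1(Y^*(G))}\le\epsilon\qquad\text{and}\qquad |r(G)-r(\hat G)|\le\epsilon .$$ -/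

import Mathlib

open MeasureTheory Set Filter Topology
open scoped ContDiff

noncomputable section

namespace CellProblem

/-- `g` is the weak partial derivative of `u` in the direction `e` on the open set `Ω ⊆ ℝ²`. -/
def IsWeakPartial (Ω : Set (ℝ × ℝ)) (e : ℝ × ℝ) (u g : ℝ × ℝ → ℝ) : Prop :=
  ∀ φ : ℝ × ℝ → ℝ, ContDiff ℝ ∞ φ → HasCompactSupport φ → tsupport φ ⊆ Ω →
    ∫ z in Ω, u z * fderiv ℝ φ z e = -∫ z in Ω, g z * φ z

/-- `g` is a square-integrable weak partial derivative of `u` in the direction `e` on `Ω`. -/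
def IsL2WeakPartial (Ω : Set (ℝ × ℝ)) (e : ℝ × ℝ) (u g : ℝ × ℝ → ℝ) : Prop :=
  MemLp g 2 (volume.restrict Ω) ∧ IsWeakPartial Ω e u g

/-- Membership in the Sobolev space `H¹(Ω)`. -/
def MemH1 (Ω : Set (ℝ × ℝ)) (u : ℝ × ℝ → ℝ) : Prop :=
  MemLp u 2 (volume.restrict Ω) ∧
    (∃ g, IsL2WeakPartial Ω (1, 0) u g) ∧ (∃ g, IsL2WeakPartial Ω (0, 1) u g)

/-- A representative of the weak partial derivative of `u` in the direction `e`
(which is unique almost everywhere on the open set `Ω` when it exists). -/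
def weakPartial (Ω : Set (ℝ × ℝ)) (e : ℝ × ℝ) (u : ℝ × ℝ → ℝ) : ℝ × ℝ → ℝ :=
  Classical.epsilon (IsL2WeakPartial Ω e u)

/-- The weak derivative `∂u/∂y₁` on `Ω`. -/
def dOne (Ω : Set (ℝ × ℝ)) (u : ℝ × ℝ → ℝ) : ℝ × ℝ → ℝ := weakPartial Ω (1, 0) u

/-- The weak derivative `∂u/∂y₂` on `Ω`. -/
def dTwo (Ω : Set (ℝ × ℝ)) (u : ℝ × ℝ → ℝ) : ℝ × ℝ → ℝ := weakPartial Ω (0, 1) u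

/-- The `H¹(Ω)` norm of a function `u` in `H¹(Ω)`. -/
def h1Norm (Ω : Set (ℝ × ℝ)) (u : ℝ × ℝ → ℝ) : ℝ :=
  Real.sqrt (∫ z in Ω, (u z ^ 2 + dOne Ω u z ^ 2 + dTwo Ω u z ^ 2))

/-- `t` is the trace of `u ∈ H¹(Ω)` on the part `γ(I)` of the boundary of `Ω`, expressed in the
parameter `s ∈ I`: for some `C¹` functions `φₙ` on the plane with `φₙ → u` in `H¹(Ω)`, the
restrictions `φₙ ∘ γ` converge to `t` in `L²(I)`. -/
def IsTrace (Ω : Set (ℝ × ℝ)) (γ : ℝ → ℝ × ℝ) (I : Set ℝ) (u : ℝ × ℝ → ℝ) (t : ℝ → ℝ) : Prop :=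
  MemLp t 2 (volume.restrict I) ∧
    ∃ φ : ℕ → ℝ × ℝ → ℝ, (∀ n, ContDiff ℝ 1 (φ n)) ∧
      Tendsto (fun n => h1Norm Ω (fun z => φ n z - u z)) atTop (𝓝 0) ∧
      Tendsto (fun n => ∫ s in I, (φ n (γ s) - t s) ^ 2) atTop (𝓝 0)

/-- The admissible profiles `A(M)`: `C¹`, `L`-periodic, `G₀ ≤ G ≤ G₁`, `|G'| ≤ M`. -/
def admissible (L G₀ G₁ M : ℝ) : Set (ℝ → ℝ) :=
  {G | ContDiff ℝ 1 G ∧ Function.Periodic G L ∧ (∀ s, G₀ ≤ G s ∧ G s ≤ G₁) ∧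
    ∀ s, |deriv G s| ≤ M}

/-- The `C¹(ℝ)` norm (of a function that is bounded with bounded derivative). -/
def c1Norm (f : ℝ → ℝ) : ℝ := (⨆ s, |f s|) + ⨆ s, |deriv f s|

/-- The basic cell `Y*(G) = {0 < y₁ < L, 0 < y₂ < G(y₁)}`. -/
def cell (L : ℝ) (G : ℝ → ℝ) : Set (ℝ × ℝ) :=
  {y | 0 < y.1 ∧ y.1 < L ∧ 0 < y.2 ∧ y.2 < G y.1}

/-- `t` is the trace of `u` on the left side `{0} × (0, G(0))` of the cell. -/
def IsLeftTrace (L : ℝ) (G : ℝ → ℝ) (u : ℝ × ℝ → ℝ) (t : ℝ → ℝ) : Prop :=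
  IsTrace (cell L G) (fun s => (0, s)) (Ioo 0 (G 0)) u t

/-- `t` is the trace of `u` on the right side `{L} × (0, G(L))` of the cell. -/
def IsRightTrace (L : ℝ) (G : ℝ → ℝ) (u : ℝ × ℝ → ℝ) (t : ℝ → ℝ) : Prop :=
  IsTrace (cell L G) (fun s => (L, s)) (Ioo 0 (G L)) u t

/-- `t` is the trace of `u` on the upper boundary `B₁(G) = {(s, G(s)) : 0 < s < L}`. -/
def IsTopTrace (L : ℝ) (G : ℝ → ℝ) (u : ℝ × ℝ → ℝ) (t : ℝ → ℝ) : Prop :=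
  IsTrace (cell L G) (fun s => (s, G s)) (Ioo 0 L) u t

/-- The space `H(G)`: functions of `H¹(Y*(G))` whose traces on the two lateral sides agree,
with zero mean. -/
def MemH (L : ℝ) (G : ℝ → ℝ) (u : ℝ × ℝ → ℝ) : Prop :=
  MemH1 (cell L G) u ∧ (∃ t, IsLeftTrace L G u t ∧ IsRightTrace L G u t) ∧
    ∫ z in cell L G, u z = 0

/-- `X` is a weak solution of the cell problem `-ΔX = 0` in `Y*(G)`, `∂X/∂N = 0` on the lower
boundary, `∂X/∂N = N₁ = -G'/√(1+G'²)` on `B₁(G)`, `X` periodic in `y₁`, `∫ X = 0`. The surface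
integral over `B₁(G)` is written in the parameter `s`, with `dS = √(1+G'(s)²) ds`. -/
def IsCellSolution (L : ℝ) (G : ℝ → ℝ) (X : ℝ × ℝ → ℝ) : Prop :=
  MemH L G X ∧ ∀ V, MemH L G V → ∀ v, IsTopTrace L G V v →
    ∫ z in cell L G, (dOne (cell L G) X z * dOne (cell L G) V z +
        dTwo (cell L G) X z * dTwo (cell L G) V z) =
      -∫ s in Ioo 0 L, deriv G s / Real.sqrt (1 + deriv G s ^ 2) * v s *
        Real.sqrt (1 + deriv G s ^ 2)

/-- `X(G)`: the solution of the cell problem in `Y*(G)`. -/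
def cellSolution (L : ℝ) (G : ℝ → ℝ) : ℝ × ℝ → ℝ :=
  Classical.epsilon (IsCellSolution L G)

/-- The change of variables `Y*(G) → Y*(Ĝ)`, `(z₁, z₂) ↦ (z₁, (Ĝ(z₁)/G(z₁)) z₂)`. -/
def cellMap (G Ĝ : ℝ → ℝ) (z : ℝ × ℝ) : ℝ × ℝ := (z.1, Ĝ z.1 / G z.1 * z.2)

/-- `U(Ĝ)` on the reference cell `Y*(G)`: the pull-back of `X(Ĝ)` minus its mean. -/
def pulledSolution (L : ℝ) (G Ĝ : ℝ → ℝ) (z : ℝ × ℝ) : ℝ :=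
  cellSolution L Ĝ (cellMap G Ĝ z) - ⨍ w in cell L G, cellSolution L Ĝ (cellMap G Ĝ w)

/-- The effective coefficient `r(G) = |Y*(G)|⁻¹ ∫_{Y*(G)} (1 - ∂X(G)/∂y₁)`. -/
def effCoeff (L : ℝ) (G : ℝ → ℝ) : ℝ :=
  ⨍ y in cell L G, (1 - dOne (cell L G) (cellSolution L G) y)

end CellProblem

end

open CellProblem

/-!
Every cell `Y*(G)` is the image of the fixed rectangle `(0, L) × (0, 1)` under the stretching
`(x, y) ↦ (x, G(x) y)`, and the pull-back `U(Ĝ)` of `X(Ĝ)` to `Y*(G)` corresponds on the rectangle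
to the same function as `X(Ĝ)` itself, up to a constant. The cell problems for all profiles thus
become variational problems on one and the same Hilbert space, in which only the bilinear form and
the right-hand side depend on `G`:

* the bilinear form `cellForm L G` is the Dirichlet integral of the cell in stretched coordinates,
  with coefficients `G`, `G' y`, `(1 + (G' y)²) / G`;
* the functional `cellFun L G` is the boundary integral over `B₁(G)`. In the parameter `s` it is
  `-∫ G' v ds`, and the trace is written as `v(x) = ∫₀¹ ∂₂(y φ) dy = ∫₀¹ (φ + y ∂₂φ) dy`, so that it
  only involves the function and its gradient on the rectangle.

The Hilbert space `perSpace L` consists of the triples `(u, ∂₁u, ∂₂u)` in `L²` which are limits of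
`C¹` functions, have zero mean, and satisfy `∫₀ᴸ ∂₁u(x, y) dx = 0` for almost every `y`; the last
condition says that the lateral traces agree. Approximability by `C¹` functions is part of the
existence of a trace, so no density theorem is needed: the Poincaré inequality, the trace
formulas and the chain rule are proved for `C¹` functions and pass to the limit.

Poincaré's inequality on the rectangle makes `cellForm L G` coercive, with a constant depending only
on `L`, `G₀`, `G₁`, `M` (`coercive_cellForm`). The Lax–Milgram theorem gives existence and
uniqueness, and `Represents.isCellSolution_iff` transfers them to the cell. Both the form and the
functional are Lipschitz in `G` for the `C¹` norm, hence so are the solution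
(`exists_norm_sub_le`) and the effective coefficient, which is `1` minus the quotient of a
continuous functional of the solution and the area of the cell
(`exists_abs_fluxFun_div_sub_le`).
-/

noncomputable section

namespace CellProblem

open scoped ENNReal InnerProductSpace

/-! ### Convergence in `L²` -/

section L2

variable {α : Type*} [MeasurableSpace α] {μ : Measure α}

/-- Convergence in `L²(μ)` of a sequence of functions. -/
def L2Tendsto (μ : Measure α) (f : ℕ → α → ℝ) (u : α → ℝ) : Prop :=
  Tendsto (fun n => eLpNorm (f n - u) 2 μ) atTop (𝓝 0)

lemma toReal_eLpNorm_two_sq {f : α → ℝ} (hf : MemLp f 2 μ) :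
    (eLpNorm f 2 μ).toReal ^ 2 = ∫ z, f z ^ 2 ∂μ := by
  rw [← Lp.norm_toLp f hf, ← real_inner_self_eq_norm_sq, L2.inner_def]
  refine integral_congr_ae ?_
  filter_upwards [hf.coeFn_toLp] with z hz
  simp [hz, sq]

lemma integral_mul_eq_inner {f g : α → ℝ} (hf : MemLp f 2 μ) (hg : MemLp g 2 μ) :
    ⟪hf.toLp f, hg.toLp g⟫_ℝ = ∫ z, f z * g z ∂μ := by
  rw [L2.inner_def]
  refine integral_congr_ae ?_
  filter_upwards [hf.coeFn_toLp, hg.coeFn_toLp] with z hz hz'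
  simp [hz, hz', mul_comm]

lemma integrable_mul_of_memLp {f g : α → ℝ} (hf : MemLp f 2 μ) (hg : MemLp g 2 μ) :
    Integrable (fun z => f z * g z) μ := hf.integrable_mul hg

lemma l2Tendsto_iff_integral {f : ℕ → α → ℝ} {u : α → ℝ} (hf : ∀ n, MemLp (f n) 2 μ)
    (hu : MemLp u 2 μ) :
    L2Tendsto μ f u ↔ Tendsto (fun n => ∫ z, (f n z - u z) ^ 2 ∂μ) atTop (𝓝 0) := by
  have h1 : ∀ n, ∫ z, (f n z - u z) ^ 2 ∂μ = (eLpNorm (f n - u) 2 μ).toReal ^ 2 := fun n =>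
    (toReal_eLpNorm_two_sq ((hf n).sub hu)).symm
  have h2 : L2Tendsto μ f u ↔
      Tendsto (fun n => (eLpNorm (f n - u) 2 μ).toReal) atTop (𝓝 0) := by
    rw [← ENNReal.toReal_zero,
      ENNReal.tendsto_toReal_iff (fun n => ((hf n).sub hu).eLpNorm_ne_top) ENNReal.zero_ne_top]
    rfl
  rw [h2]
  simp_rw [h1]
  constructor
  · intro h
    simpa using h.pow 2
  · intro h
    have := (Real.continuous_sqrt.tendsto 0).comp h
    simpa [Function.comp_def, Real.sqrt_sq ENNReal.toReal_nonneg] using this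

lemma l2Tendsto_iff_toLp {f : ℕ → α → ℝ} {u : α → ℝ} (hf : ∀ n, MemLp (f n) 2 μ)
    (hu : MemLp u 2 μ) :
    L2Tendsto μ f u ↔ Tendsto (fun n => (hf n).toLp (f n)) atTop (𝓝 (hu.toLp u)) :=
  (Lp.tendsto_Lp_iff_tendsto_eLpNorm'' f hf u hu).symm

lemma L2Tendsto.integral_mul {f : ℕ → α → ℝ} {u h : α → ℝ} (H : L2Tendsto μ f u)
    (hf : ∀ n, MemLp (f n) 2 μ) (hu : MemLp u 2 μ) (hh : MemLp h 2 μ) :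
    Tendsto (fun n => ∫ z, f n z * h z ∂μ) atTop (𝓝 (∫ z, u z * h z ∂μ)) := by
  simp_rw [← fun n => integral_mul_eq_inner (hf n) hh]
  rw [← integral_mul_eq_inner hu hh]
  exact ((l2Tendsto_iff_toLp hf hu).1 H).inner tendsto_const_nhds

lemma L2Tendsto.unique {f : ℕ → α → ℝ} {u v : α → ℝ} (hf : ∀ n, MemLp (f n) 2 μ)
    (hu : MemLp u 2 μ) (hv : MemLp v 2 μ) (H : L2Tendsto μ f u) (H' : L2Tendsto μ f v) :
    u =ᵐ[μ] v :=
  (MemLp.toLp_eq_toLp_iff hu hv).1 (tendsto_nhds_unique ((l2Tendsto_iff_toLp hf hu).1 H)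
    ((l2Tendsto_iff_toLp hf hv).1 H'))

lemma L2Tendsto.add {f g : ℕ → α → ℝ} {u v : α → ℝ} (hf : ∀ n, MemLp (f n) 2 μ)
    (hu : MemLp u 2 μ) (hg : ∀ n, MemLp (g n) 2 μ) (hv : MemLp v 2 μ)
    (H : L2Tendsto μ f u) (H' : L2Tendsto μ g v) :
    L2Tendsto μ (fun n z => f n z + g n z) (fun z => u z + v z) :=
  (l2Tendsto_iff_toLp (fun n => (hf n).add (hg n)) (hu.add hv)).2
    (((l2Tendsto_iff_toLp hf hu).1 H).add ((l2Tendsto_iff_toLp hg hv).1 H'))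

lemma memLp_bdd_mul {b f : α → ℝ} {C : ℝ} (hb : Measurable b) (hC : ∀ᵐ z ∂μ, |b z| ≤ C)
    (hf : MemLp f 2 μ) : MemLp (fun z => b z * f z) 2 μ := by
  refine hf.of_le_mul (c := C) (hb.aestronglyMeasurable.mul hf.1) ?_
  filter_upwards [hC] with z hz
  rw [norm_mul]
  exact mul_le_mul_of_nonneg_right hz (norm_nonneg _)

lemma L2Tendsto.bdd_mul {f : ℕ → α → ℝ} {u b : α → ℝ} {C : ℝ}
    (hC : ∀ᵐ z ∂μ, |b z| ≤ C) (H : L2Tendsto μ f u) :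
    L2Tendsto μ (fun n z => b z * f n z) (fun z => b z * u z) := by
  have h1 : ∀ n, eLpNorm ((fun z => b z * f n z) - fun z => b z * u z) 2 μ ≤
      ENNReal.ofReal C * eLpNorm (f n - u) 2 μ := by
    intro n
    refine eLpNorm_le_mul_eLpNorm_of_ae_le_mul ?_ 2
    filter_upwards [hC] with z hz
    simp only [Pi.sub_apply, ← mul_sub, norm_mul]
    exact mul_le_mul_of_nonneg_right hz (norm_nonneg _)
  refine tendsto_of_tendsto_of_tendsto_of_le_of_le tendsto_const_nhds ?_ (fun _ => zero_le) h1
  simpa using ENNReal.Tendsto.const_mul H (Or.inr ENNReal.ofReal_ne_top)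

/-- `L²` convergence is preserved by a change of variables which does not concentrate the measure
by more than a constant factor. -/
lemma L2Tendsto.comp {β : Type*} [MeasurableSpace β] {ν : Measure β} {T : β → α} {C : ℝ≥0∞}
    (hT : Measurable T) (hC : C ≠ ⊤) (hν : ν.map T ≤ C • μ) {f : ℕ → α → ℝ} {u : α → ℝ}
    (hf : ∀ n, MemLp (f n) 2 μ) (hu : MemLp u 2 μ) (H : L2Tendsto μ f u) :
    L2Tendsto ν (fun n z => f n (T z)) (fun z => u (T z)) := by
  have h1 : ∀ n, eLpNorm ((fun z => f n (T z)) - fun z => u (T z)) 2 ν ≤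
      C ^ (1 / (2 : ℝ≥0∞)).toReal * eLpNorm (f n - u) 2 μ := by
    intro n
    have h2 := ((hf n).sub hu).of_measure_le_smul hC hν
    have h3 : eLpNorm ((fun z => f n (T z)) - fun z => u (T z)) 2 ν =
        eLpNorm (f n - u) 2 (ν.map T) := (eLpNorm_map_measure h2.1 hT.aemeasurable).symm
    rw [h3]
    refine (eLpNorm_mono_measure _ hν).trans ?_
    rw [eLpNorm_smul_measure_of_ne_top (by simp)]
    simp
  refine tendsto_of_tendsto_of_tendsto_of_le_of_le tendsto_const_nhds ?_ (fun _ => zero_le) h1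
  simpa using ENNReal.Tendsto.const_mul H
    (Or.inr (ENNReal.rpow_ne_top_of_nonneg (by positivity) hC))

lemma memLp_comp {β : Type*} [MeasurableSpace β] {ν : Measure β} {T : β → α} {C : ℝ≥0∞}
    (hT : Measurable T) (hC : C ≠ ⊤) (hν : ν.map T ≤ C • μ) {u : α → ℝ} (hu : MemLp u 2 μ) :
    MemLp (fun z => u (T z)) 2 ν :=
  (hu.of_measure_le_smul hC hν).comp_of_map hT.aemeasurable

end L2

/-! ### Weak derivatives and limits of `C¹` functions -/

section Weak

variable {Ω : Set (ℝ × ℝ)} {e : ℝ × ℝ}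

lemma memLp_of_continuous {α : Type*} [PseudoMetricSpace α] [ProperSpace α] [MeasurableSpace α]
    [BorelSpace α] {μ : Measure α} [IsFiniteMeasureOnCompacts μ] {Ω : Set α}
    (hb : Bornology.IsBounded Ω) {f : α → ℝ} (hf : Continuous f) :
    MemLp f 2 (μ.restrict Ω) := by
  have hc : IsCompact (closure Ω) := hb.isCompact_closure
  have : IsFiniteMeasure (μ.restrict (closure Ω)) :=
    ⟨by simpa using hc.measure_lt_top⟩
  obtain ⟨C, hC⟩ := hc.exists_bound_of_continuousOn hf.continuousOn
  have : MemLp f 2 (μ.restrict (closure Ω)) := by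
    refine MemLp.of_bound hf.aestronglyMeasurable C ?_
    filter_upwards [ae_restrict_mem isClosed_closure.measurableSet] with z hz using hC z hz
  exact this.mono_measure (Measure.restrict_mono subset_closure le_rfl)

lemma continuous_fderiv_dir {φ : ℝ × ℝ → ℝ} (hφ : ContDiff ℝ 1 φ) (e : ℝ × ℝ) :
    Continuous (fun z => fderiv ℝ φ z e) :=
  (hφ.continuous_fderiv one_ne_zero).clm_apply continuous_const

lemma isL2WeakPartial_of_contDiff (hb : Bornology.IsBounded Ω) {φ : ℝ × ℝ → ℝ}
    (hφ : ContDiff ℝ 1 φ) (e : ℝ × ℝ) :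
    IsL2WeakPartial Ω e φ (fun z => fderiv ℝ φ z e) := by
  refine ⟨memLp_of_continuous hb (continuous_fderiv_dir hφ e), fun η hη hc hs => ?_⟩
  have hη1 : ContDiff ℝ 1 η := hη.of_le (by exact_mod_cast le_top)
  have hd := continuous_fderiv_dir hη1 e
  have hcd : HasCompactSupport (fun z => fderiv ℝ η z e) := hc.fderiv_apply ℝ e
  have hz : ∀ z, z ∉ Ω → η z = 0 := fun z hz => image_eq_zero_of_notMem_tsupport fun h => hz (hs h)
  have hz' : ∀ z, z ∉ Ω → fderiv ℝ η z e = 0 := fun z hz => by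
    rw [fderiv_of_notMem_tsupport (𝕜 := ℝ) (fun h => hz (hs h))]; rfl
  rw [setIntegral_eq_integral_of_forall_compl_eq_zero (fun z h => by simp [hz' z h]),
    setIntegral_eq_integral_of_forall_compl_eq_zero (fun z h => by simp [hz z h])]
  refine integral_mul_fderiv_eq_neg_fderiv_mul_of_integrable ?_ ?_ ?_ ?_ ?_
  · exact ((continuous_fderiv_dir hφ e).mul hη.continuous).integrable_of_hasCompactSupport
      hc.mul_left
  · exact (hφ.continuous.mul hd).integrable_of_hasCompactSupport hcd.mul_left
  · exact (hφ.continuous.mul hη.continuous).integrable_of_hasCompactSupport hc.mul_left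
  · exact fun x _ => (hφ.differentiable one_ne_zero) x
  · exact fun x _ => (hη1.differentiable one_ne_zero) x

lemma memLp_testFunction {η : ℝ × ℝ → ℝ} (hη : Continuous η) (hc : HasCompactSupport η) :
    MemLp η 2 (volume.restrict Ω) :=
  (hη.memLp_of_hasCompactSupport hc).restrict Ω

/-- Weak derivatives are unique almost everywhere. -/
lemma IsL2WeakPartial.ae_eq (hΩ : IsOpen Ω) {u g g' : ℝ × ℝ → ℝ} (h : IsL2WeakPartial Ω e u g)
    (h' : IsL2WeakPartial Ω e u g') : g =ᵐ[volume.restrict Ω] g' := by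
  have hm := h.1.sub h'.1
  have key := hΩ.ae_eq_zero_of_integral_contDiff_smul_eq_zero (μ := volume) (f := g - g')
    (locallyIntegrableOn_of_locallyIntegrable_restrict (hm.locallyIntegrable (by norm_num))) ?_
  · rw [EventuallyEq, ae_restrict_iff' hΩ.measurableSet]
    filter_upwards [key] with z hz hzΩ
    exact sub_eq_zero.1 (hz hzΩ)
  · intro η hη hc hs
    have hl := memLp_testFunction (Ω := Ω) hη.continuous hc
    have h1 := h.2 η hη hc hs
    have h2 := h'.2 η hη hc hs
    rw [← setIntegral_eq_integral_of_forall_compl_eq_zero (s := Ω)]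
    · have : ∀ z, η z • (g - g') z = g z * η z - g' z * η z := fun z => by
        simp only [smul_eq_mul, Pi.sub_apply]; ring
      simp_rw [this]
      rw [integral_sub (integrable_mul_of_memLp h.1 hl) (integrable_mul_of_memLp h'.1 hl)]
      linarith
    · intro z hz
      rw [image_eq_zero_of_notMem_tsupport fun h => hz (hs h), zero_smul]

lemma IsL2WeakPartial.weakPartial_ae_eq (hΩ : IsOpen Ω) {u g : ℝ × ℝ → ℝ}
    (h : IsL2WeakPartial Ω e u g) : weakPartial Ω e u =ᵐ[volume.restrict Ω] g :=
  (Classical.epsilon_spec (p := IsL2WeakPartial Ω e u) ⟨g, h⟩).ae_eq hΩ h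

lemma IsL2WeakPartial.sub {u v g k : ℝ × ℝ → ℝ} (hu : MemLp u 2 (volume.restrict Ω))
    (hv : MemLp v 2 (volume.restrict Ω)) (h : IsL2WeakPartial Ω e u g)
    (h' : IsL2WeakPartial Ω e v k) :
    IsL2WeakPartial Ω e (fun z => u z - v z) (fun z => g z - k z) := by
  refine ⟨h.1.sub h'.1, fun η hη hc hs => ?_⟩
  have hη1 : ContDiff ℝ 1 η := hη.of_le (by exact_mod_cast le_top)
  have hl := memLp_testFunction (Ω := Ω) hη.continuous hc
  have hl' := memLp_testFunction (Ω := Ω) (continuous_fderiv_dir hη1 e) (hc.fderiv_apply ℝ e)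
  simp_rw [sub_mul]
  rw [integral_sub (integrable_mul_of_memLp hu hl') (integrable_mul_of_memLp hv hl'),
    integral_sub (integrable_mul_of_memLp h.1 hl) (integrable_mul_of_memLp h'.1 hl),
    h.2 η hη hc hs, h'.2 η hη hc hs]
  ring

/-- Weak differentiation is a closed operation in `L²`. -/
lemma IsL2WeakPartial.of_l2Tendsto {f d : ℕ → ℝ × ℝ → ℝ} {u g : ℝ × ℝ → ℝ}
    (hf : ∀ n, MemLp (f n) 2 (volume.restrict Ω)) (hu : MemLp u 2 (volume.restrict Ω))
    (hd : ∀ n, IsL2WeakPartial Ω e (f n) (d n)) (hg : MemLp g 2 (volume.restrict Ω))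
    (H : L2Tendsto (volume.restrict Ω) f u) (H' : L2Tendsto (volume.restrict Ω) d g) :
    IsL2WeakPartial Ω e u g := by
  refine ⟨hg, fun η hη hc hs => ?_⟩
  have hη1 : ContDiff ℝ 1 η := hη.of_le (by exact_mod_cast le_top)
  have hl := memLp_testFunction (Ω := Ω) hη.continuous hc
  have hl' := memLp_testFunction (Ω := Ω) (continuous_fderiv_dir hη1 e) (hc.fderiv_apply ℝ e)
  refine tendsto_nhds_unique (H.integral_mul hf hu hl') ?_
  simp_rw [fun n => (hd n).2 η hη hc hs]
  exact (H'.integral_mul (fun n => (hd n).1) hg hl).neg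

/-- The `C¹` functions `φ n` converge in `H¹(Ω)` to `u`, whose partial derivatives are `g₁`
and `g₂`. -/
structure H1Limit (Ω : Set (ℝ × ℝ)) (φ : ℕ → ℝ × ℝ → ℝ) (u g₁ g₂ : ℝ × ℝ → ℝ) : Prop where
  contDiff : ∀ n, ContDiff ℝ 1 (φ n)
  memLp : MemLp u 2 (volume.restrict Ω)
  memLp₁ : MemLp g₁ 2 (volume.restrict Ω)
  memLp₂ : MemLp g₂ 2 (volume.restrict Ω)
  tendsto : L2Tendsto (volume.restrict Ω) φ u
  tendsto₁ : L2Tendsto (volume.restrict Ω) (fun n z => fderiv ℝ (φ n) z (1, 0)) g₁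
  tendsto₂ : L2Tendsto (volume.restrict Ω) (fun n z => fderiv ℝ (φ n) z (0, 1)) g₂

variable {φ : ℕ → ℝ × ℝ → ℝ} {u g₁ g₂ : ℝ × ℝ → ℝ}

lemma H1Limit.memLp_approx (h : H1Limit Ω φ u g₁ g₂) (hb : Bornology.IsBounded Ω) (n : ℕ) :
    MemLp (φ n) 2 (volume.restrict Ω) := memLp_of_continuous hb (h.contDiff n).continuous

lemma H1Limit.memLp_fderiv_approx (h : H1Limit Ω φ u g₁ g₂) (hb : Bornology.IsBounded Ω)
    (e : ℝ × ℝ) (n : ℕ) : MemLp (fun z => fderiv ℝ (φ n) z e) 2 (volume.restrict Ω) :=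
  memLp_of_continuous hb (continuous_fderiv_dir (h.contDiff n) e)

lemma H1Limit.weak₁ (h : H1Limit Ω φ u g₁ g₂) (hb : Bornology.IsBounded Ω) :
    IsL2WeakPartial Ω (1, 0) u g₁ :=
  .of_l2Tendsto (h.memLp_approx hb) h.memLp
    (fun n => isL2WeakPartial_of_contDiff hb (h.contDiff n) _) h.memLp₁ h.tendsto h.tendsto₁

lemma H1Limit.weak₂ (h : H1Limit Ω φ u g₁ g₂) (hb : Bornology.IsBounded Ω) :
    IsL2WeakPartial Ω (0, 1) u g₂ :=
  .of_l2Tendsto (h.memLp_approx hb) h.memLp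
    (fun n => isL2WeakPartial_of_contDiff hb (h.contDiff n) _) h.memLp₂ h.tendsto h.tendsto₂

lemma H1Limit.memH1 (h : H1Limit Ω φ u g₁ g₂) (hb : Bornology.IsBounded Ω) : MemH1 Ω u :=
  ⟨h.memLp, ⟨g₁, h.weak₁ hb⟩, ⟨g₂, h.weak₂ hb⟩⟩

lemma MemH1.dOne_spec (h : MemH1 Ω u) : IsL2WeakPartial Ω (1, 0) u (dOne Ω u) :=
  Classical.epsilon_spec h.2.1

lemma MemH1.dTwo_spec (h : MemH1 Ω u) : IsL2WeakPartial Ω (0, 1) u (dTwo Ω u) :=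
  Classical.epsilon_spec h.2.2

lemma h1Norm_eq (hΩ : IsOpen Ω) (hu : MemLp u 2 (volume.restrict Ω))
    (h₁ : IsL2WeakPartial Ω (1, 0) u g₁) (h₂ : IsL2WeakPartial Ω (0, 1) u g₂) :
    h1Norm Ω u = √((∫ z in Ω, u z ^ 2) + (∫ z in Ω, g₁ z ^ 2) + ∫ z in Ω, g₂ z ^ 2) := by
  rw [h1Norm, ← integral_add hu.integrable_sq h₁.1.integrable_sq, ← integral_add
    (f := fun z => u z ^ 2 + g₁ z ^ 2) (hu.integrable_sq.add h₁.1.integrable_sq)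
    h₂.1.integrable_sq]
  congr 1
  refine integral_congr_ae ?_
  filter_upwards [h₁.weakPartial_ae_eq hΩ, h₂.weakPartial_ae_eq hΩ] with z hz hz'
  rw [dOne, dTwo, hz, hz']

/-- Convergence of `C¹` functions in the norm `h1Norm`, which involves chosen representatives of the
weak derivatives, is `L²` convergence of the functions and of their classical derivatives. -/
lemma tendsto_h1Norm_iff (hΩ : IsOpen Ω) (hb : Bornology.IsBounded Ω)
    (hφ : ∀ n, ContDiff ℝ 1 (φ n)) (hu : MemLp u 2 (volume.restrict Ω))
    (h₁ : IsL2WeakPartial Ω (1, 0) u g₁) (h₂ : IsL2WeakPartial Ω (0, 1) u g₂) :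
    Tendsto (fun n => h1Norm Ω (fun z => φ n z - u z)) atTop (𝓝 0) ↔ H1Limit Ω φ u g₁ g₂ := by
  have hc := fun n => memLp_of_continuous (μ := volume) hb (hφ n).continuous
  have hw := fun n => isL2WeakPartial_of_contDiff hb (hφ n)
  have h3 : ∀ n, h1Norm Ω (fun z => φ n z - u z) = √((∫ z in Ω, (φ n z - u z) ^ 2) +
      (∫ z in Ω, (fderiv ℝ (φ n) z (1, 0) - g₁ z) ^ 2) +
      ∫ z in Ω, (fderiv ℝ (φ n) z (0, 1) - g₂ z) ^ 2) := fun n =>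
    h1Norm_eq hΩ ((hc n).sub hu) ((hw n _).sub (hc n) hu h₁) ((hw n _).sub (hc n) hu h₂)
  simp_rw [h3]
  have p : ∀ f : ℝ × ℝ → ℝ, 0 ≤ ∫ z in Ω, f z ^ 2 := fun f => integral_nonneg fun z => sq_nonneg _
  constructor
  · intro h
    have h4 := h.pow 2
    simp_rw [Real.sq_sqrt (add_nonneg (add_nonneg (p _) (p _)) (p _)), zero_pow two_ne_zero] at h4
    refine ⟨hφ, hu, h₁.1, h₂.1, (l2Tendsto_iff_integral hc hu).2 ?_,
      (l2Tendsto_iff_integral (fun n => (hw n _).1) h₁.1).2 ?_,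
      (l2Tendsto_iff_integral (fun n => (hw n _).1) h₂.1).2 ?_⟩ <;>
    refine tendsto_of_tendsto_of_tendsto_of_le_of_le tendsto_const_nhds h4
      (fun n => p _) (fun n => ?_) <;> dsimp only
    · linarith [p fun z => fderiv ℝ (φ n) z (1, 0) - g₁ z,
        p fun z => fderiv ℝ (φ n) z (0, 1) - g₂ z]
    · linarith [p fun z => φ n z - u z, p fun z => fderiv ℝ (φ n) z (0, 1) - g₂ z]
    · linarith [p fun z => φ n z - u z, p fun z => fderiv ℝ (φ n) z (1, 0) - g₁ z]
  · intro h
    have t := (((l2Tendsto_iff_integral hc hu).1 h.tendsto).add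
      ((l2Tendsto_iff_integral (fun n => (hw n _).1) h₁.1).1 h.tendsto₁)).add
      ((l2Tendsto_iff_integral (fun n => (hw n _).1) h₂.1).1 h.tendsto₂)
    simpa [Function.comp_def] using (Real.continuous_sqrt.tendsto _).comp t

lemma H1Limit.congr (h : H1Limit Ω φ u g₁ g₂) {u' g₁' g₂' : ℝ × ℝ → ℝ}
    (hu : u =ᵐ[volume.restrict Ω] u') (h₁ : g₁ =ᵐ[volume.restrict Ω] g₁')
    (h₂ : g₂ =ᵐ[volume.restrict Ω] g₂') : H1Limit Ω φ u' g₁' g₂' := by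
  have key : ∀ {f : ℕ → ℝ × ℝ → ℝ} {v w : ℝ × ℝ → ℝ}, v =ᵐ[volume.restrict Ω] w →
      L2Tendsto (volume.restrict Ω) f v → L2Tendsto (volume.restrict Ω) f w := by
    intro f v w hvw h
    refine h.congr fun n => eLpNorm_congr_ae ?_
    filter_upwards [hvw] with z hz
    simp [hz]
  exact ⟨h.contDiff, (memLp_congr_ae hu).1 h.memLp, (memLp_congr_ae h₁).1 h.memLp₁,
    (memLp_congr_ae h₂).1 h.memLp₂, key hu h.tendsto, key h₁ h.tendsto₁, key h₂ h.tendsto₂⟩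

end Weak

/-! ### Vertical stretching of cells -/

section Stretch

lemma isOpen_cell {L : ℝ} {G : ℝ → ℝ} (hG : Continuous G) : IsOpen (cell L G) := by
  have : cell L G = {y | 0 < y.1} ∩ {y | y.1 < L} ∩ {y | 0 < y.2} ∩ {y | y.2 < G y.1} := by
    ext y; simp [cell, and_assoc]
  rw [this]
  exact (((isOpen_lt continuous_const continuous_fst).inter
    (isOpen_lt continuous_fst continuous_const)).inter
    (isOpen_lt continuous_const continuous_snd)).inter
    (isOpen_lt continuous_snd (hG.comp continuous_fst))

lemma isBounded_cell {L C : ℝ} {G : ℝ → ℝ} (hG : ∀ s, G s ≤ C) :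
    Bornology.IsBounded (cell L G) :=
  ((Metric.isBounded_Icc 0 L).prod (Metric.isBounded_Icc 0 C)).subset fun _ hy =>
    ⟨⟨hy.1.le, hy.2.1.le⟩, ⟨hy.2.2.1.le, hy.2.2.2.le.trans (hG _)⟩⟩

/-- The map `(x, y) ↦ (x, k(x) y)`. -/
def stretch (k : ℝ → ℝ) (z : ℝ × ℝ) : ℝ × ℝ := (z.1, k z.1 * z.2)

variable {k g : ℝ → ℝ} {L c C : ℝ}

lemma contDiff_stretch (hk : ContDiff ℝ 1 k) : ContDiff ℝ 1 (stretch k) :=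
  contDiff_fst.prodMk ((hk.comp contDiff_fst).mul contDiff_snd)

lemma injective_stretch (hk : ∀ s, 0 < k s) : Function.Injective (stretch k) := by
  rintro ⟨a, b⟩ ⟨a', b'⟩ h
  simp only [stretch, Prod.mk.injEq] at h
  obtain ⟨rfl, h⟩ := h
  rw [mul_right_inj' (hk a).ne'] at h
  rw [h]

lemma stretch_mem_cell (hk : ∀ s, 0 < k s) {z : ℝ × ℝ} :
    stretch k z ∈ cell L (fun s => k s * g s) ↔ z ∈ cell L g := by
  simp only [cell, stretch, mem_ofPred_eq]
  rw [mul_pos_iff_of_pos_left (hk _), mul_lt_mul_iff_right₀ (hk _)]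

lemma stretch_inv_stretch (hk : ∀ s, 0 < k s) (z : ℝ × ℝ) :
    stretch (fun s => (k s)⁻¹) (stretch k z) = z := by
  simp [stretch, inv_mul_cancel_left₀ (hk _).ne']

lemma stretch_stretch_inv (hk : ∀ s, 0 < k s) (z : ℝ × ℝ) :
    stretch k (stretch (fun s => (k s)⁻¹) z) = z := by
  simp [stretch, mul_inv_cancel_left₀ (hk _).ne']

lemma image_stretch (hk : ∀ s, 0 < k s) :
    stretch k '' cell L g = cell L (fun s => k s * g s) := by
  ext z
  constructor
  · rintro ⟨w, hw, rfl⟩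
    exact (stretch_mem_cell hk).2 hw
  · intro hz
    refine ⟨_, ?_, stretch_stretch_inv hk z⟩
    rwa [← stretch_mem_cell hk, stretch_stretch_inv hk]

/-- The derivative of `stretch k`. -/
def stretchDeriv (k : ℝ → ℝ) (z : ℝ × ℝ) : ℝ × ℝ →L[ℝ] ℝ × ℝ :=
  (ContinuousLinearMap.fst ℝ ℝ ℝ).prod (k z.1 • ContinuousLinearMap.snd ℝ ℝ ℝ +
    (deriv k z.1 * z.2) • ContinuousLinearMap.fst ℝ ℝ ℝ)

lemma hasFDerivAt_stretch (hk : ContDiff ℝ 1 k) (z : ℝ × ℝ) :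
    HasFDerivAt (stretch k) (stretchDeriv k z) z := by
  have h1 : HasFDerivAt (fun z : ℝ × ℝ => k z.1)
      (deriv k z.1 • ContinuousLinearMap.fst ℝ ℝ ℝ) z :=
    ((hk.differentiable one_ne_zero z.1).hasDerivAt).comp_hasFDerivAt z hasFDerivAt_fst
  have h2 := (hasFDerivAt_fst (𝕜 := ℝ) (p := z)).prodMk (h1.mul (hasFDerivAt_snd (p := z)))
  refine h2.congr_fderiv ?_
  ext <;> simp [stretchDeriv, mul_comm]

lemma det_stretchDeriv (k : ℝ → ℝ) (z : ℝ × ℝ) : (stretchDeriv k z).det = k z.1 := by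
  rw [ContinuousLinearMap.det, ← LinearMap.det_toMatrix (Module.Basis.finTwoProd ℝ),
    Matrix.det_fin_two]
  simp [LinearMap.toMatrix_apply, stretchDeriv]

lemma setIntegral_cell_stretch (hk : ContDiff ℝ 1 k) (hp : ∀ s, 0 < k s) (hg : Continuous g)
    (f : ℝ × ℝ → ℝ) :
    ∫ z in cell L (fun s => k s * g s), f z = ∫ z in cell L g, k z.1 * f (stretch k z) := by
  rw [← image_stretch hp, integral_image_eq_integral_abs_det_fderiv_smul volume
    (isOpen_cell hg).measurableSet (fun z _ => (hasFDerivAt_stretch hk z).hasFDerivWithinAt)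
    (injective_stretch hp).injOn]
  simp_rw [det_stretchDeriv, abs_of_pos (hp _), smul_eq_mul]

/-- The push-forward of Lebesgue measure under a stretching by a factor `k ≥ c` has density at
most `1 / c`. -/
lemma map_stretch_le (hk : ContDiff ℝ 1 k) (hc : 0 < c) (hp : ∀ s, c ≤ k s)
    (hg : Continuous g) :
    (volume.restrict (cell L g)).map (stretch k) ≤
      ENNReal.ofReal c⁻¹ • volume.restrict (cell L (fun s => k s * g s)) := by
  have hp' : ∀ s, 0 < k s := fun s => hc.trans_le (hp s)
  have hm : Measurable (stretch k) := (contDiff_stretch hk).continuous.measurable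
  refine Measure.le_iff.2 fun A hA => ?_
  rw [Measure.map_apply hm hA, Measure.restrict_apply (hm hA), Measure.smul_apply,
    Measure.restrict_apply hA]
  set B := stretch k ⁻¹' A ∩ cell L g with hB
  have hBm : MeasurableSet B := (hm hA).inter (isOpen_cell hg).measurableSet
  have him : stretch k '' B = A ∩ cell L (fun s => k s * g s) := by
    rw [hB, image_preimage_inter, image_stretch hp']
  rw [← him, ← lintegral_abs_det_fderiv_eq_addHaar_image volume hBm
    (fun z _ => (hasFDerivAt_stretch hk z).hasFDerivWithinAt) (injective_stretch hp').injOn]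
  have h1 : ENNReal.ofReal c * volume B ≤
      ∫⁻ z in B, ENNReal.ofReal |(stretchDeriv k z).det| := by
    rw [← setLIntegral_const]
    refine lintegral_mono fun z => ENNReal.ofReal_le_ofReal ?_
    rw [det_stretchDeriv]
    exact (hp _).trans (le_abs_self _)
  calc volume B = ENNReal.ofReal c⁻¹ * (ENNReal.ofReal c * volume B) := by
        rw [← mul_assoc, ← ENNReal.ofReal_mul (inv_nonneg.2 hc.le), inv_mul_cancel₀ hc.ne']
        simp
    _ ≤ _ := by
        rw [smul_eq_mul]
        gcongr

lemma ae_stretch (hk : ContDiff ℝ 1 k) (hc : 0 < c) (hp : ∀ s, c ≤ k s) (hg : Continuous g)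
    {p : ℝ × ℝ → Prop} (h : ∀ᵐ z ∂volume.restrict (cell L (fun s => k s * g s)), p z) :
    ∀ᵐ z ∂volume.restrict (cell L g), p (stretch k z) := by
  have hm : Measurable (stretch k) := (contDiff_stretch hk).continuous.measurable
  have h1 := (Measure.absolutelyContinuous_of_le_smul (map_stretch_le hk hc hp hg)).ae_le h
  exact ae_of_ae_map hm.aemeasurable h1

lemma fderiv_comp_stretch (hk : ContDiff ℝ 1 k) {φ : ℝ × ℝ → ℝ} (hφ : ContDiff ℝ 1 φ)
    (z : ℝ × ℝ) :
    fderiv ℝ (fun z => φ (stretch k z)) z (1, 0) =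
        fderiv ℝ φ (stretch k z) (1, 0) +
          deriv k z.1 * z.2 * fderiv ℝ φ (stretch k z) (0, 1) ∧
      fderiv ℝ (fun z => φ (stretch k z)) z (0, 1) =
        k z.1 * fderiv ℝ φ (stretch k z) (0, 1) := by
  have h := ((hφ.differentiable one_ne_zero (stretch k z)).hasFDerivAt.comp z
    (hasFDerivAt_stretch hk z)).fderiv
  have h' : fderiv ℝ (fun z => φ (stretch k z)) z =
    (fderiv ℝ φ (stretch k z)).comp (stretchDeriv k z) := h
  have e1 : stretchDeriv k z (1, 0) = (1, 0) + (deriv k z.1 * z.2) • (0, 1) := by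
    simp [stretchDeriv]
  have e2 : stretchDeriv k z (0, 1) = k z.1 • (0, 1) := by simp [stretchDeriv]
  rw [h', ContinuousLinearMap.comp_apply, ContinuousLinearMap.comp_apply, e1, e2, map_add,
    map_smul, map_smul]
  exact ⟨rfl, rfl⟩

/-- Composition with the stretching `(x, y) ↦ (x, k(x) y)` preserves `H¹` limits of `C¹`
functions, with the usual chain rule for the gradient. -/
lemma H1Limit.comp_stretch (hk : ContDiff ℝ 1 k) (hc : 0 < c) (hp : ∀ s, c ≤ k s)
    (hC : ∀ s, k s ≤ C) (hC' : ∀ s, |deriv k s| ≤ C) (hg : Continuous g) (hgC : ∀ s, g s ≤ C)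
    {φ : ℕ → ℝ × ℝ → ℝ} {u g₁ g₂ : ℝ × ℝ → ℝ}
    (h : H1Limit (cell L (fun s => k s * g s)) φ u g₁ g₂) :
    H1Limit (cell L g) (fun n z => φ n (stretch k z)) (fun z => u (stretch k z))
      (fun z => g₁ (stretch k z) + deriv k z.1 * z.2 * g₂ (stretch k z))
      (fun z => k z.1 * g₂ (stretch k z)) := by
  have hm : Measurable (stretch k) := (contDiff_stretch hk).continuous.measurable
  have hle := map_stretch_le (L := L) hk hc hp hg
  have hne := ENNReal.ofReal_ne_top (r := c⁻¹)
  have hC0 : 0 ≤ C := (abs_nonneg _).trans (hC' 0)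
  have hb : Bornology.IsBounded (cell L (fun s => k s * g s)) :=
    isBounded_cell (C := C * C) fun s =>
      (mul_le_mul_of_nonneg_left (hgC s) (hc.le.trans (hp s))).trans
        (mul_le_mul_of_nonneg_right (hC s) hC0)
  have b1 : ∀ᵐ z ∂volume.restrict (cell L g), |deriv k z.1 * z.2| ≤ C * C := by
    filter_upwards [ae_restrict_mem (isOpen_cell hg).measurableSet] with z hz
    rw [abs_mul, abs_of_pos hz.2.2.1]
    exact mul_le_mul (hC' _) (hz.2.2.2.le.trans (hgC _)) hz.2.2.1.le hC0
  have b2 : ∀ᵐ z ∂volume.restrict (cell L g), |k z.1| ≤ C := .of_forall fun z => by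
    rw [abs_of_pos (hc.trans_le (hp _))]; exact hC _
  have m1 : Measurable (fun z : ℝ × ℝ => deriv k z.1 * z.2) :=
    ((measurable_deriv k).comp measurable_fst).mul measurable_snd
  have m2 : Measurable (fun z : ℝ × ℝ => k z.1) := hk.continuous.measurable.comp measurable_fst
  have M : ∀ {v : ℝ × ℝ → ℝ}, MemLp v 2 (volume.restrict (cell L (fun s => k s * g s))) →
    MemLp (fun z => v (stretch k z)) 2 (volume.restrict (cell L g)) := fun hv =>
      memLp_comp hm hne hle hv
  have c0 := h.memLp_approx hb
  have c1 := h.memLp_fderiv_approx hb (1, 0)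
  have c2 := h.memLp_fderiv_approx hb (0, 1)
  have t1 := h.tendsto₁.comp hm hne hle c1 h.memLp₁
  have t2 := h.tendsto₂.comp hm hne hle c2 h.memLp₂
  refine ⟨fun n => (h.contDiff n).comp (contDiff_stretch hk), M h.memLp,
    (M h.memLp₁).add (memLp_bdd_mul m1 b1 (M h.memLp₂)), memLp_bdd_mul m2 b2 (M h.memLp₂),
    h.tendsto.comp hm hne hle c0 h.memLp, ?_, ?_⟩
  · simp_rw [fun n z => (fderiv_comp_stretch hk (h.contDiff n) z).1]
    exact t1.add (fun n => M (c1 n)) (M h.memLp₁) (fun n => memLp_bdd_mul m1 b1 (M (c2 n)))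
      (memLp_bdd_mul m1 b1 (M h.memLp₂)) (t2.bdd_mul b1)
  · simp_rw [fun n z => (fderiv_comp_stretch hk (h.contDiff n) z).2]
    exact t2.bdd_mul b2

end Stretch

/-! ### The reference rectangle -/

section Rectangle

lemma sq_integral_mul_le {α : Type*} [MeasurableSpace α] {μ : Measure α} {f g : α → ℝ}
    (hf : MemLp f 2 μ) (hg : MemLp g 2 μ) :
    (∫ z, f z * g z ∂μ) ^ 2 ≤ (∫ z, f z ^ 2 ∂μ) * ∫ z, g z ^ 2 ∂μ := by
  have h := real_inner_mul_inner_self_le (hf.toLp f) (hg.toLp g)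
  simp_rw [integral_mul_eq_inner] at h
  simpa only [sq] using h

lemma sq_integral_le {α : Type*} [MeasurableSpace α] {μ : Measure α} [IsFiniteMeasure μ]
    {f : α → ℝ} (hf : MemLp f 2 μ) :
    (∫ z, f z ∂μ) ^ 2 ≤ μ.real univ * ∫ z, f z ^ 2 ∂μ := by
  simpa [mul_comm] using sq_integral_mul_le hf (memLp_const (1 : ℝ))

section Prod

variable {α β : Type*} [MeasurableSpace α] [MeasurableSpace β] {μ : Measure α} {ν : Measure β}
  [IsFiniteMeasure μ] [IsFiniteMeasure ν]

lemma ae_memLp_prod_right {f : α × β → ℝ} (hf : MemLp f 2 (μ.prod ν)) :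
    ∀ᵐ x ∂μ, MemLp (fun y => f (x, y)) 2 ν := by
  filter_upwards [hf.integrable_sq.prod_right_ae, hf.1.prodMk_left] with x hx hm
  exact (memLp_two_iff_integrable_sq hm).2 hx

/-- Integration over one variable is bounded on `L²` of a product of finite measures. -/
lemma memLp_integral_prod {f : α × β → ℝ} (hf : MemLp f 2 (μ.prod ν)) :
    MemLp (fun x => ∫ y, f (x, y) ∂ν) 2 μ ∧
      ∫ x, (∫ y, f (x, y) ∂ν) ^ 2 ∂μ ≤ ν.real univ * ∫ z, f z ^ 2 ∂(μ.prod ν) := by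
  have hm : AEStronglyMeasurable (fun x => ∫ y, f (x, y) ∂ν) μ := hf.1.integral_prod_right'
  have h1 : ∀ᵐ x ∂μ, (∫ y, f (x, y) ∂ν) ^ 2 ≤ ν.real univ * ∫ y, f (x, y) ^ 2 ∂ν := by
    filter_upwards [ae_memLp_prod_right hf] with x hx using sq_integral_le hx
  have h2 : Integrable (fun x => ν.real univ * ∫ y, f (x, y) ^ 2 ∂ν) μ :=
    hf.integrable_sq.integral_prod_left.const_mul _
  have h3 : Integrable (fun x => (∫ y, f (x, y) ∂ν) ^ 2) μ := by
    refine h2.mono' (hm.pow 2) ?_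
    filter_upwards [h1] with x hx
    rwa [Real.norm_of_nonneg (sq_nonneg _)]
  refine ⟨(memLp_two_iff_integrable_sq hm).2 h3, ?_⟩
  rw [integral_prod _ hf.integrable_sq, ← integral_const_mul]
  exact integral_mono_ae h3 h2 h1

lemma L2Tendsto.integral_prod {f : ℕ → α × β → ℝ} {u : α × β → ℝ}
    (hf : ∀ n, MemLp (f n) 2 (μ.prod ν)) (hu : MemLp u 2 (μ.prod ν))
    (H : L2Tendsto (μ.prod ν) f u) :
    L2Tendsto μ (fun n x => ∫ y, f n (x, y) ∂ν) (fun x => ∫ y, u (x, y) ∂ν) := by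
  rw [l2Tendsto_iff_integral (fun n => (memLp_integral_prod (hf n)).1) (memLp_integral_prod hu).1]
  have h := ((l2Tendsto_iff_integral hf hu).1 H).const_mul (ν.real univ)
  rw [mul_zero] at h
  refine tendsto_of_tendsto_of_tendsto_of_le_of_le tendsto_const_nhds h
    (fun n => integral_nonneg fun _ => sq_nonneg _) fun n => ?_
  refine le_trans (le_of_eq (integral_congr_ae ?_)) (memLp_integral_prod ((hf n).sub hu)).2
  filter_upwards [ae_memLp_prod_right (hf n), ae_memLp_prod_right hu] with x hx hx'
  simp only [Pi.sub_apply]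
  rw [integral_sub (hx.integrable (by norm_num)) (hx'.integrable (by norm_num))]

lemma map_swap_le : (ν.prod μ).map Prod.swap ≤ (1 : ℝ≥0∞) • μ.prod ν := by
  rw [Measure.prod_swap, one_smul]

lemma MemLp.comp_swap {f : α × β → ℝ} (hf : MemLp f 2 (μ.prod ν)) :
    MemLp (fun z : β × α => f (z.2, z.1)) 2 (ν.prod μ) :=
  memLp_comp measurable_swap ENNReal.one_ne_top map_swap_le hf

lemma L2Tendsto.integral_prod_symm {f : ℕ → α × β → ℝ} {u : α × β → ℝ}
    (hf : ∀ n, MemLp (f n) 2 (μ.prod ν)) (hu : MemLp u 2 (μ.prod ν))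
    (H : L2Tendsto (μ.prod ν) f u) :
    L2Tendsto ν (fun n y => ∫ x, f n (x, y) ∂μ) (fun y => ∫ x, u (x, y) ∂μ) := by
  have h := L2Tendsto.comp measurable_swap ENNReal.one_ne_top (map_swap_le (μ := μ) (ν := ν))
    hf hu H
  have m1 := fun n => MemLp.comp_swap (hf n)
  have m2 := MemLp.comp_swap hu
  have h' := L2Tendsto.integral_prod m1 m2 h
  exact h'

end Prod

/-- The open rectangle `(0, L) × (0, 1)`. -/
abbrev rect (L : ℝ) : Set (ℝ × ℝ) := cell L fun _ => 1

lemma rect_eq (L : ℝ) : rect L = Ioo 0 L ×ˢ Ioo 0 1 := by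
  ext z; simp [rect, cell, and_assoc]

lemma restrict_rect (L : ℝ) : (volume : Measure (ℝ × ℝ)).restrict (rect L) =
    (volume.restrict (Ioo 0 L)).prod (volume.restrict (Ioo 0 1)) := by
  rw [rect_eq, Measure.prod_restrict, Measure.volume_eq_prod]

lemma isBounded_rect (L : ℝ) : Bornology.IsBounded (rect L) :=
  isBounded_cell (C := 1) fun _ => le_rfl

lemma isOpen_rect (L : ℝ) : IsOpen (rect L) := isOpen_cell continuous_const

instance (L : ℝ) : IsFiniteMeasure ((volume : Measure (ℝ × ℝ)).restrict (rect L)) := by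
  rw [restrict_rect]; infer_instance

lemma hasDerivAt_fst {φ : ℝ × ℝ → ℝ} (hφ : ContDiff ℝ 1 φ) (x y : ℝ) :
    HasDerivAt (fun x => φ (x, y)) (fderiv ℝ φ (x, y) (1, 0)) x := by
  have h1 : HasDerivAt (fun x : ℝ => (x, y)) ((1 : ℝ), (0 : ℝ)) x :=
    (hasDerivAt_id x).prodMk (hasDerivAt_const x y)
  exact (hφ.differentiable one_ne_zero (x, y)).hasFDerivAt.comp_hasDerivAt x h1

lemma hasDerivAt_snd {φ : ℝ × ℝ → ℝ} (hφ : ContDiff ℝ 1 φ) (x y : ℝ) :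
    HasDerivAt (fun y => φ (x, y)) (fderiv ℝ φ (x, y) (0, 1)) y := by
  have h1 : HasDerivAt (fun y : ℝ => (x, y)) ((0 : ℝ), (1 : ℝ)) y :=
    (hasDerivAt_const y x).prodMk (hasDerivAt_id y)
  exact (hφ.differentiable one_ne_zero (x, y)).hasFDerivAt.comp_hasDerivAt y h1

/-- The integral of the derivative of `(x - a) f(x)`; for `a = l` and `a = 0` it expresses the two
boundary values of `f` through integrals, which is how traces are computed. -/
lemma integral_Ioo_deriv_sub_mul {f f' : ℝ → ℝ} (hf : ∀ x, HasDerivAt f (f' x) x)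
    (hf' : Continuous f') {l : ℝ} (hl : 0 ≤ l) (a : ℝ) :
    ∫ x in Ioo 0 l, (f x + (x - a) * f' x) = (l - a) * f l + a * f 0 := by
  have hc : Continuous f := continuous_iff_continuousAt.2 fun x => (hf x).continuousAt
  have hd : ∀ x, HasDerivAt (fun x => (x - a) * f x) (f x + (x - a) * f' x) x := fun x => by
    simpa using ((hasDerivAt_id x).sub_const a).fun_mul (hf x)
  rw [← integral_Ioc_eq_integral_Ioo, ← intervalIntegral.integral_of_le hl,
    intervalIntegral.integral_eq_sub_of_hasDerivAt (fun x _ => hd x)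
      (Continuous.intervalIntegrable (by fun_prop) _ _)]
  ring

lemma abs_sub_le_integral_Ioo {f f' : ℝ → ℝ} (hf : ∀ x, HasDerivAt f (f' x) x)
    (hf' : Continuous f') {l a b : ℝ} (ha : a ∈ Ioo 0 l) (hb : b ∈ Ioo 0 l) :
    |f a - f b| ≤ ∫ x in Ioo 0 l, |f' x| := by
  have hI : IntegrableOn (fun x => |f' x|) (Icc 0 l) := hf'.abs.integrableOn_Icc
  rw [← intervalIntegral.integral_eq_sub_of_hasDerivAt (fun x _ => hf x)
    (hf'.intervalIntegrable b a), ← Real.norm_eq_abs]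
  refine intervalIntegral.norm_integral_le_integral_norm_uIoc.trans ?_
  refine setIntegral_mono_set (hI.mono_set Ioo_subset_Icc_self)
    (.of_forall fun _ => abs_nonneg _) (LE.le.eventuallyLE ?_)
  intro x hx
  rw [mem_uIoc] at hx
  rcases hx with h | h
  · exact ⟨hb.1.trans h.1, h.2.trans_lt ha.2⟩
  · exact ⟨ha.1.trans h.1, h.2.trans_lt hb.2⟩

lemma measureReal_rect (hL : 0 < L) : (volume.restrict (rect L)).real univ = L := by
  rw [restrict_rect, ← univ_prod_univ, measureReal_prod_prod]; simp [hL.le]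

/-- Poincaré's inequality on the rectangle. Each value is compared with the mean by joining two
points through a horizontal and a vertical segment. -/
lemma poincare_rect {L : ℝ} (hL : 0 < L) {φ : ℝ × ℝ → ℝ} (hφ : ContDiff ℝ 1 φ) :
    ∫ z in rect L, φ z ^ 2 ≤ (2 * L ^ 2 + 2) * ((∫ z in rect L, fderiv ℝ φ z (1, 0) ^ 2) +
      ∫ z in rect L, fderiv ℝ φ z (0, 1) ^ 2) + L⁻¹ * (∫ z in rect L, φ z) ^ 2 := by
  have hb := isBounded_rect L
  have c1 := continuous_fderiv_dir hφ (1, 0)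
  have c2 := continuous_fderiv_dir hφ (0, 1)
  have i0 := memLp_of_continuous (μ := volume) hb hφ.continuous
  have i1 := memLp_of_continuous (μ := volume) hb c1
  have i2 := memLp_of_continuous (μ := volume) hb c2
  have i2' := memLp_of_continuous (μ := volume) hb c2.abs
  have hmem : ∀ᵐ z ∂(volume.restrict (rect L)), z ∈ rect L :=
    ae_restrict_mem (isOpen_rect L).measurableSet
  have hmeas := measureReal_rect hL
  set m := ∫ z in rect L, φ z with hm
  set D := ∫ z in rect L, |fderiv ℝ φ z (0, 1)| with hD
  have hD2 : D ^ 2 ≤ L * ∫ z in rect L, fderiv ℝ φ z (0, 1) ^ 2 := by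
    simpa [hmeas] using sq_integral_le i2'
  let B : ℝ → ℝ := fun x => ∫ y in Ioo 0 1, |fderiv ℝ φ (x, y) (0, 1)|
  let A : ℝ → ℝ := fun y => ∫ x in Ioo 0 L, |fderiv ℝ φ (x, y) (1, 0)|
  let S : ℝ → ℝ := fun y => ∫ x in Ioo 0 L, fderiv ℝ φ (x, y) (1, 0) ^ 2
  have i2a := i2'.integrable (by norm_num)
  have i1s := i1.integrable_sq
  rw [restrict_rect] at i2a i1s
  have hBi : Integrable (fun z : ℝ × ℝ => B z.1) (volume.restrict (rect L)) := by
    rw [restrict_rect]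
    exact Integrable.comp_fst i2a.integral_prod_left _
  have hSi : Integrable (fun z : ℝ × ℝ => S z.2) (volume.restrict (rect L)) := by
    rw [restrict_rect]
    exact Integrable.comp_snd i1s.integral_prod_right _
  have hBint : ∫ z in rect L, B z.1 = D := by
    rw [hD, restrict_rect, integral_fun_fst, integral_prod _ i2a]
    simp [B]
  have hSint : ∫ z in rect L, S z.2 = L * ∫ z in rect L, fderiv ℝ φ z (1, 0) ^ 2 := by
    rw [restrict_rect, integral_fun_snd, integral_prod_symm _ i1s]
    simp [S, hL.le]
  have hAS : ∀ y, A y ^ 2 ≤ L * S y := by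
    intro y
    have h : MemLp (fun x => |fderiv ℝ φ (x, y) (1, 0)|) 2 (volume.restrict (Ioo 0 L)) := by
      have hc : Continuous (fun x => |fderiv ℝ φ (x, y) (1, 0)|) := by fun_prop
      refine ((memLp_two_iff_integrable_sq hc.aestronglyMeasurable).2 ?_)
      exact ((hc.pow 2).integrableOn_Icc (a := 0) (b := L)).mono_set Ioo_subset_Icc_self
    simpa [hL.le] using sq_integral_le h
  have hpt : ∀ z ∈ rect L, |L * φ z - m| ≤ L * A z.2 + D := by
    rintro ⟨x, y⟩ hz
    have hz' := hz
    rw [rect_eq] at hz'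
    have e1 : L * φ (x, y) - m = ∫ w in rect L, (φ (x, y) - φ w) := by
      rw [integral_sub (integrable_const _) (i0.integrable (by norm_num)), integral_const, hmeas,
        smul_eq_mul]
    rw [e1, ← Real.norm_eq_abs]
    have e2 : L * A y + D = ∫ w in rect L, (A y + B w.1) := by
      rw [integral_add (integrable_const _) hBi, integral_const, hmeas, smul_eq_mul, hBint]
    rw [e2]
    refine norm_integral_le_of_norm_le ((integrable_const _).add hBi) ?_
    filter_upwards [hmem] with w hw
    rw [rect_eq] at hw
    calc ‖φ (x, y) - φ w‖ = |(φ (x, y) - φ (w.1, y)) + (φ (w.1, y) - φ (w.1, w.2))| := by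
          rw [Real.norm_eq_abs]; congr 1; ring
      _ ≤ _ := (abs_add_le _ _).trans (add_le_add
        (abs_sub_le_integral_Ioo (f := fun x => φ (x, y)) (fun x => hasDerivAt_fst hφ x y)
          (by fun_prop) hz'.1 hw.1)
        (abs_sub_le_integral_Ioo (f := fun y => φ (w.1, y)) (fun y => hasDerivAt_snd hφ w.1 y)
          (by fun_prop) hz'.2 hw.2))
  have hint : ∫ z in rect L, (L * φ z - m) ^ 2 ≤
      ∫ z in rect L, (2 * L ^ 3 * S z.2 + 2 * D ^ 2) := by
    refine integral_mono_ae ((i0.const_mul L).sub (memLp_const m)).integrable_sq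
      ((hSi.const_mul _).add (integrable_const _)) ?_
    filter_upwards [hmem] with z hz
    have h1 := hpt z hz
    have h2 := hAS z.2
    have h3 : (L * φ z - m) ^ 2 ≤ (L * A z.2 + D) ^ 2 := sq_le_sq' (by
      linarith [abs_le.1 h1]) (abs_le.1 h1).2
    have h4 : L ^ 2 * A z.2 ^ 2 ≤ L ^ 2 * (L * S z.2) := by gcongr
    nlinarith [sq_nonneg (L * A z.2 - D)]
  have hr : ∫ z in rect L, (2 * L ^ 3 * S z.2 + 2 * D ^ 2) =
      2 * L ^ 4 * (∫ z in rect L, fderiv ℝ φ z (1, 0) ^ 2) + 2 * L * D ^ 2 := by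
    rw [integral_add (hSi.const_mul _) (integrable_const _), integral_const_mul, hSint,
      integral_const, hmeas, smul_eq_mul]
    ring
  have hl : ∫ z in rect L, (L * φ z - m) ^ 2 = L ^ 2 * (∫ z in rect L, φ z ^ 2) - L * m ^ 2 := by
    have e : ∀ z, (L * φ z - m) ^ 2 = L ^ 2 * φ z ^ 2 - 2 * L * m * φ z + m ^ 2 := fun z => by ring
    simp_rw [e]
    rw [integral_add (f := fun z => L ^ 2 * φ z ^ 2 - 2 * L * m * φ z)
      ((i0.integrable_sq.const_mul _).sub ((i0.integrable (by norm_num)).const_mul _))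
      (integrable_const _), integral_sub (i0.integrable_sq.const_mul _)
      ((i0.integrable (by norm_num)).const_mul _),
      integral_const_mul, integral_const_mul, integral_const, hmeas, ← hm, smul_eq_mul]
    ring
  rw [hr, hl] at hint
  set I0 := ∫ z in rect L, φ z ^ 2
  set I1 := ∫ z in rect L, fderiv ℝ φ z (1, 0) ^ 2 with hI1
  set I2 := ∫ z in rect L, fderiv ℝ φ z (0, 1) ^ 2 with hI2
  have p1 : 0 ≤ I1 := integral_nonneg fun _ => sq_nonneg _
  have p2 : 0 ≤ I2 := integral_nonneg fun _ => sq_nonneg _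
  have h5 : L ^ 2 * I0 ≤ L ^ 2 * ((2 * L ^ 2 + 2) * (I1 + I2) + L⁻¹ * m ^ 2) := by
    have h6 : L ^ 2 * (L⁻¹ * m ^ 2) = L * m ^ 2 := by field_simp
    have h7 : 2 * L * D ^ 2 ≤ 2 * L * (L * I2) := by gcongr
    nlinarith [mul_nonneg (sq_nonneg L) p1, mul_nonneg (sq_nonneg (L ^ 2)) p2,
      mul_nonneg (sq_nonneg (L ^ 2)) p1, mul_nonneg (sq_nonneg L) p2]
  exact le_of_mul_le_mul_left h5 (by positivity)

/-- The trace on the left side of the rectangle of a function with horizontal derivative `g₁`,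
obtained from `L φ(0, y) = ∫₀ᴸ ∂₁((x - L) φ) dx`. -/
def leftTr (L : ℝ) (u g₁ : ℝ × ℝ → ℝ) (y : ℝ) : ℝ :=
  L⁻¹ * ∫ x in Ioo 0 L, (u (x, y) + (x - L) * g₁ (x, y))

/-- The trace on the right side of the rectangle of a function with horizontal derivative `g₁`,
obtained from `L φ(L, y) = ∫₀ᴸ ∂₁(x φ) dx`. -/
def rightTr (L : ℝ) (u g₁ : ℝ × ℝ → ℝ) (y : ℝ) : ℝ :=
  L⁻¹ * ∫ x in Ioo 0 L, (u (x, y) + (x - 0) * g₁ (x, y))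

/-- The trace on the top side of the rectangle of a function with vertical derivative `g₂`,
obtained from `φ(x, 1) = ∫₀¹ ∂₂(y φ) dy`. -/
def topTr (u g₂ : ℝ × ℝ → ℝ) (x : ℝ) : ℝ :=
  ∫ y in Ioo 0 1, (u (x, y) + (y - 0) * g₂ (x, y))

variable {L : ℝ} {φ : ℕ → ℝ × ℝ → ℝ} {u g₁ g₂ : ℝ × ℝ → ℝ}

lemma ae_abs_fst_sub_le {a : ℝ} (ha : a ∈ Icc 0 L) :
    ∀ᵐ z ∂(volume.restrict (rect L)), |z.1 - a| ≤ L := by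
  filter_upwards [ae_restrict_mem (isOpen_rect L).measurableSet] with z hz
  rw [abs_le]
  constructor <;> linarith [hz.1, hz.2.1, ha.1, ha.2]

lemma ae_abs_snd_sub_le : ∀ᵐ z ∂(volume.restrict (rect L)), |z.2 - 0| ≤ 1 := by
  filter_upwards [ae_restrict_mem (isOpen_rect L).measurableSet] with z hz
  rw [sub_zero, abs_of_pos hz.2.2.1]
  exact hz.2.2.2.le

lemma memLp_add_fst_sub_mul {a : ℝ} (ha : a ∈ Icc 0 L) {u g : ℝ × ℝ → ℝ}
    (hu : MemLp u 2 (volume.restrict (rect L))) (hg : MemLp g 2 (volume.restrict (rect L))) :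
    MemLp (fun z => u z + (z.1 - a) * g z) 2 (volume.restrict (rect L)) :=
  hu.add (memLp_bdd_mul (measurable_fst.sub_const a) (ae_abs_fst_sub_le ha) hg)

lemma memLp_add_snd_sub_mul {u g : ℝ × ℝ → ℝ}
    (hu : MemLp u 2 (volume.restrict (rect L))) (hg : MemLp g 2 (volume.restrict (rect L))) :
    MemLp (fun z => u z + (z.2 - 0) * g z) 2 (volume.restrict (rect L)) :=
  hu.add (memLp_bdd_mul (measurable_snd.sub_const 0) ae_abs_snd_sub_le hg)

lemma memLp_lateral {a : ℝ} (ha : a ∈ Icc 0 L)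
    (hu : MemLp u 2 (volume.restrict (rect L))) (hg : MemLp g₁ 2 (volume.restrict (rect L))) :
    MemLp (fun y => ∫ x in Ioo 0 L, (u (x, y) + (x - a) * g₁ (x, y))) 2
      (volume.restrict (Ioo 0 1)) := by
  have m := memLp_add_fst_sub_mul ha hu hg
  rw [restrict_rect] at m
  exact (memLp_integral_prod (MemLp.comp_swap m)).1

/-- The lateral boundary values of the approximating `C¹` functions converge in `L²`: `a = L` gives
the left side and `a = 0` the right side. -/
lemma H1Limit.tendsto_lateral (hL : 0 < L) (h : H1Limit (rect L) φ u g₁ g₂) {a : ℝ}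
    (ha : a ∈ Icc 0 L) :
    L2Tendsto (volume.restrict (Ioo 0 1)) (fun n y => (L - a) * φ n (L, y) + a * φ n (0, y))
      (fun y => ∫ x in Ioo 0 L, (u (x, y) + (x - a) * g₁ (x, y))) := by
  have hb := isBounded_rect L
  have c0 := h.memLp_approx hb
  have c1 := h.memLp_fderiv_approx hb (1, 0)
  have hba := ae_abs_fst_sub_le ha
  have hme : Measurable fun z : ℝ × ℝ => z.1 - a := measurable_fst.sub_const a
  have m := memLp_add_fst_sub_mul ha h.memLp h.memLp₁
  have mn := fun n => memLp_add_fst_sub_mul ha (c0 n) (c1 n)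
  have t := h.tendsto.add c0 h.memLp (fun n => memLp_bdd_mul hme hba (c1 n))
    (memLp_bdd_mul hme hba h.memLp₁) (h.tendsto₁.bdd_mul hba)
  rw [restrict_rect] at m mn t
  refine (t.integral_prod_symm mn m).congr fun n => ?_
  congr 1
  ext y
  simp only [Pi.sub_apply]
  rw [integral_Ioo_deriv_sub_mul (f := fun x => φ n (x, y))
    (fun x => hasDerivAt_fst (h.contDiff n) x y)
    ((continuous_fderiv_dir (h.contDiff n) (1, 0)).comp (by fun_prop)) hL.le a]

lemma L2Tendsto.const_mul {α : Type*} [MeasurableSpace α] {μ : Measure α} {f : ℕ → α → ℝ}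
    {u : α → ℝ} (c : ℝ) (H : L2Tendsto μ f u) :
    L2Tendsto μ (fun n z => c * f n z) (fun z => c * u z) :=
  H.bdd_mul (C := |c|) (.of_forall fun _ => le_rfl)

lemma memLp_leftTr (hL : 0 < L) (hu : MemLp u 2 (volume.restrict (rect L)))
    (hg : MemLp g₁ 2 (volume.restrict (rect L))) :
    MemLp (leftTr L u g₁) 2 (volume.restrict (Ioo 0 1)) :=
  (memLp_lateral ⟨hL.le, le_rfl⟩ hu hg).const_mul _

lemma memLp_rightTr (hL : 0 < L) (hu : MemLp u 2 (volume.restrict (rect L)))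
    (hg : MemLp g₁ 2 (volume.restrict (rect L))) :
    MemLp (rightTr L u g₁) 2 (volume.restrict (Ioo 0 1)) :=
  (memLp_lateral ⟨le_rfl, hL.le⟩ hu hg).const_mul _

lemma H1Limit.tendsto_leftTr (hL : 0 < L) (h : H1Limit (rect L) φ u g₁ g₂) :
    L2Tendsto (volume.restrict (Ioo 0 1)) (fun n y => φ n (0, y)) (leftTr L u g₁) := by
  refine ((h.tendsto_lateral hL ⟨hL.le, le_rfl⟩).const_mul L⁻¹).congr fun n => ?_
  congr 1
  ext y
  simp [leftTr, hL.ne']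

lemma H1Limit.tendsto_rightTr (hL : 0 < L) (h : H1Limit (rect L) φ u g₁ g₂) :
    L2Tendsto (volume.restrict (Ioo 0 1)) (fun n y => φ n (L, y)) (rightTr L u g₁) := by
  refine ((h.tendsto_lateral hL ⟨le_rfl, hL.le⟩).const_mul L⁻¹).congr fun n => ?_
  congr 1
  ext y
  simp [rightTr, hL.ne']

lemma memLp_topTr (hu : MemLp u 2 (volume.restrict (rect L)))
    (hg : MemLp g₂ 2 (volume.restrict (rect L))) :
    MemLp (topTr u g₂) 2 (volume.restrict (Ioo 0 L)) := by
  have m := memLp_add_snd_sub_mul hu hg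
  rw [restrict_rect] at m
  exact (memLp_integral_prod m).1

lemma H1Limit.tendsto_topTr (h : H1Limit (rect L) φ u g₁ g₂) :
    L2Tendsto (volume.restrict (Ioo 0 L)) (fun n x => φ n (x, 1)) (topTr u g₂) := by
  have hb := isBounded_rect L
  have c0 := h.memLp_approx hb
  have c1 := h.memLp_fderiv_approx hb (0, 1)
  have hba := ae_abs_snd_sub_le (L := L)
  have hme : Measurable fun z : ℝ × ℝ => z.2 - 0 := measurable_snd.sub_const 0
  have m := memLp_add_snd_sub_mul h.memLp h.memLp₂
  have mn := fun n => memLp_add_snd_sub_mul (c0 n) (c1 n)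
  have t := h.tendsto.add c0 h.memLp (fun n => memLp_bdd_mul hme hba (c1 n))
    (memLp_bdd_mul hme hba h.memLp₂) (h.tendsto₂.bdd_mul hba)
  rw [restrict_rect] at m mn t
  refine (t.integral_prod mn m).congr fun n => ?_
  congr 1
  ext x
  simp only [Pi.sub_apply, topTr]
  rw [integral_Ioo_deriv_sub_mul (f := fun y => φ n (x, y))
    (fun y => hasDerivAt_snd (h.contDiff n) x y)
    ((continuous_fderiv_dir (h.contDiff n) (0, 1)).comp (by fun_prop)) zero_le_one 0]
  simp

/-- The lateral traces differ by the horizontal integrals of the derivative. -/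
lemma rightTr_sub_leftTr (hL : 0 < L) (hu : MemLp u 2 (volume.restrict (rect L)))
    (hg : MemLp g₁ 2 (volume.restrict (rect L))) :
    ∀ᵐ y ∂(volume.restrict (Ioo (0 : ℝ) 1)),
      rightTr L u g₁ y - leftTr L u g₁ y = ∫ x in Ioo 0 L, g₁ (x, y) := by
  have m := memLp_add_fst_sub_mul ⟨hL.le, le_rfl⟩ hu hg
  have m' := memLp_add_fst_sub_mul ⟨le_rfl, hL.le⟩ hu hg
  rw [restrict_rect] at m m'
  filter_upwards [ae_memLp_prod_right (MemLp.comp_swap m),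
    ae_memLp_prod_right (MemLp.comp_swap m')] with y h1 h2
  rw [rightTr, leftTr, ← mul_sub, ← integral_sub (h2.integrable (by norm_num))
    (h1.integrable (by norm_num)), ← integral_const_mul]
  refine integral_congr_ae (.of_forall fun x => ?_)
  field_simp
  ring

end Rectangle

/-! ### Variational problems on a closed subspace -/

section LaxMilgram

variable {E : Type*} [NormedAddCommGroup E] [InnerProductSpace ℝ E]
  {H : Submodule ℝ E} {B B' : E →L[ℝ] E →L[ℝ] ℝ} {ℓ ℓ' : E →L[ℝ] ℝ} {c : ℝ}

/-- The Lax–Milgram theorem on a closed subspace. -/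
lemma exists_variational_solution [CompleteSpace E] (hH : IsClosed (H : Set E)) (hc : 0 < c)
    (hB : ∀ k ∈ H, c * ‖k‖ ^ 2 ≤ B k k) (ℓ : E →L[ℝ] ℝ) : ∃ k ∈ H, ∀ l ∈ H, B k l = ℓ l := by
  have : CompleteSpace H := hH.completeSpace_coe
  let b : H →L[ℝ] H →L[ℝ] ℝ := B.bilinearComp H.subtypeL H.subtypeL
  have hco : IsCoercive b := ⟨c, hc, fun u => by
    have := hB u u.2
    rw [sq, ← mul_assoc] at this
    exact this⟩
  let w : H := (InnerProductSpace.toDual ℝ H).symm (ℓ ∘L H.subtypeL)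
  refine ⟨hco.continuousLinearEquivOfBilin.symm w, Submodule.coe_mem _, fun l hl => ?_⟩
  have h1 := hco.continuousLinearEquivOfBilin_apply
    (hco.continuousLinearEquivOfBilin.symm w) ⟨l, hl⟩
  rw [ContinuousLinearEquiv.apply_symm_apply, InnerProductSpace.toDual_symm_apply] at h1
  exact h1.symm

lemma norm_le_div_of_mul_sq_le {x Λ : ℝ} (hc : 0 < c) (hx : 0 ≤ x) (hΛ : 0 ≤ Λ)
    (h : c * x ^ 2 ≤ Λ * x) : x ≤ Λ / c := by
  rw [le_div_iff₀ hc]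
  rcases hx.eq_or_lt with rfl | h0
  · simpa using hΛ
  · rw [sq, ← mul_assoc, mul_le_mul_iff_left₀ h0] at h
    linarith

lemma norm_variational_solution_le (hc : 0 < c) (hB : ∀ k ∈ H, c * ‖k‖ ^ 2 ≤ B k k) {k : E}
    (hk : k ∈ H) (hs : ∀ l ∈ H, B k l = ℓ l) {Λ : ℝ} (hΛ : 0 ≤ Λ) (hℓ : ∀ l, |ℓ l| ≤ Λ * ‖l‖) :
    ‖k‖ ≤ Λ / c :=
  norm_le_div_of_mul_sq_le hc (norm_nonneg k) hΛ
    ((((hB k hk).trans_eq (hs k hk)).trans (le_abs_self _)).trans (hℓ k))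

/-- Continuous dependence of the solution of a coercive variational problem on the data. -/
lemma norm_variational_solution_sub_le (hc : 0 < c) (hB : ∀ k ∈ H, c * ‖k‖ ^ 2 ≤ B k k) {k k' : E}
    (hk : k ∈ H) (hs : ∀ l ∈ H, B k l = ℓ l) (hk' : k' ∈ H) (hs' : ∀ l ∈ H, B' k' l = ℓ' l)
    {η θ : ℝ} (hη : 0 ≤ η) (hθ : 0 ≤ θ) (hBB : ∀ k l, |B k l - B' k l| ≤ η * ‖k‖ * ‖l‖)
    (hℓ : ∀ l, |ℓ l - ℓ' l| ≤ θ * ‖l‖) : ‖k - k'‖ ≤ (θ + η * ‖k'‖) / c := by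
  have hw := H.sub_mem hk hk'
  refine norm_le_div_of_mul_sq_le hc (norm_nonneg _) (by positivity) ((hB _ hw).trans ?_)
  have e : B (k - k') (k - k') = (ℓ (k - k') - ℓ' (k - k')) -
      (B k' (k - k') - B' k' (k - k')) := by
    rw [← hs _ hw, ← hs' _ hw, map_sub B, _root_.sub_apply]
    ring
  have h1 := le_abs_self (ℓ (k - k') - ℓ' (k - k'))
  have h2 := neg_abs_le (B k' (k - k') - B' k' (k - k'))
  have h3 := hℓ (k - k')
  have h4 := hBB k' (k - k')
  rw [e]
  linarith

end LaxMilgram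

/-! ### The variational problem on the reference rectangle -/

section Reference

variable {L : ℝ}

/-- The space `L²` of the rectangle. -/
abbrev RectL2 (L : ℝ) : Type := Lp ℝ 2 ((volume : Measure (ℝ × ℝ)).restrict (rect L))

/-- Triples of square-integrable functions on the rectangle; a function of `H¹` is represented by
itself and its two partial derivatives. -/
abbrev Triple (L : ℝ) : Type := PiLp 2 fun _ : Fin 3 => RectL2 L

/-- A function which can be used as a coefficient: measurable, and bounded by `C` on the
rectangle. -/
def IsCoeff (L C : ℝ) (b : ℝ × ℝ → ℝ) : Prop := Measurable b ∧ ∀ z ∈ rect L, |b z| ≤ C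

lemma IsCoeff.ae_le {C : ℝ} {b : ℝ × ℝ → ℝ} (h : IsCoeff L C b) :
    ∀ᵐ z ∂(volume.restrict (rect L)), |b z| ≤ C := by
  filter_upwards [ae_restrict_mem (isOpen_rect L).measurableSet] with z hz using h.2 z hz

lemma IsCoeff.memLp_mul {C : ℝ} {b : ℝ × ℝ → ℝ} (h : IsCoeff L C b) (f : RectL2 L) :
    MemLp (fun z => b z * f z) 2 (volume.restrict (rect L)) :=
  memLp_bdd_mul h.1 h.ae_le (Lp.memLp f)

open Classical in
/-- The operator of multiplication by `b` on `L²` of the rectangle (zero if `b` is not measurable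
and bounded on the rectangle). -/
def mulL (L : ℝ) (b : ℝ × ℝ → ℝ) : RectL2 L →L[ℝ] RectL2 L :=
  if h : ∃ C, IsCoeff L C b then
    LinearMap.mkContinuous
      { toFun := fun f => (h.choose_spec.memLp_mul f).toLp _
        map_add' := fun f g => by
          refine Lp.ext ?_
          filter_upwards [(h.choose_spec.memLp_mul (f + g)).coeFn_toLp,
            (h.choose_spec.memLp_mul f).coeFn_toLp, (h.choose_spec.memLp_mul g).coeFn_toLp,
            Lp.coeFn_add f g, Lp.coeFn_add ((h.choose_spec.memLp_mul f).toLp _)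
              ((h.choose_spec.memLp_mul g).toLp _)] with z h1 h2 h3 h4 h5
          rw [h1, h5, Pi.add_apply, h2, h3, h4, Pi.add_apply, mul_add]
        map_smul' := fun c f => by
          refine Lp.ext ?_
          filter_upwards [(h.choose_spec.memLp_mul (c • f)).coeFn_toLp,
            (h.choose_spec.memLp_mul f).coeFn_toLp, Lp.coeFn_smul c f,
            Lp.coeFn_smul c ((h.choose_spec.memLp_mul f).toLp _)] with z h1 h2 h3 h4
          rw [h1, RingHom.id_apply, h4, Pi.smul_apply, h2, h3, Pi.smul_apply, smul_eq_mul,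
            smul_eq_mul, mul_left_comm] }
      h.choose fun f => by
        refine Lp.norm_le_mul_norm_of_ae_le_mul ?_
        filter_upwards [(h.choose_spec.memLp_mul f).coeFn_toLp, h.choose_spec.ae_le] with z h1 h2
        rw [LinearMap.coe_mk, AddHom.coe_mk, h1, norm_mul]
        exact mul_le_mul_of_nonneg_right h2 (norm_nonneg _)
  else 0

lemma mulL_coeFn {C : ℝ} {b : ℝ × ℝ → ℝ} (hb : IsCoeff L C b) (f : RectL2 L) :
    mulL L b f =ᵐ[volume.restrict (rect L)] fun z => b z * f z := by
  rw [mulL, dif_pos ⟨C, hb⟩]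
  exact MemLp.coeFn_toLp (hb.memLp_mul f)

lemma norm_mulL_le {C : ℝ} {b : ℝ × ℝ → ℝ} (hb : IsCoeff L C b) (f : RectL2 L) :
    ‖mulL L b f‖ ≤ C * ‖f‖ := by
  refine Lp.norm_le_mul_norm_of_ae_le_mul ?_
  filter_upwards [mulL_coeFn hb f, hb.ae_le] with z h1 h2
  rw [h1, norm_mul]
  exact mul_le_mul_of_nonneg_right h2 (norm_nonneg _)

lemma mulL_sub {C C' : ℝ} {b b' : ℝ × ℝ → ℝ} (hb : IsCoeff L C b) (hb' : IsCoeff L C' b')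
    (f : RectL2 L) : mulL L b f - mulL L b' f = mulL L (fun z => b z - b' z) f := by
  have h : IsCoeff L (C + C') (fun z => b z - b' z) := ⟨hb.1.sub hb'.1, fun z hz =>
    (abs_sub _ _).trans (add_le_add (hb.2 z hz) (hb'.2 z hz))⟩
  refine Lp.ext ?_
  filter_upwards [mulL_coeFn hb f, mulL_coeFn hb' f, mulL_coeFn h f,
    Lp.coeFn_sub (mulL L b f) (mulL L b' f)] with z h1 h2 h3 h4
  rw [h4, Pi.sub_apply, h1, h2, h3, sub_mul]

lemma inner_mulL {C : ℝ} {b : ℝ × ℝ → ℝ} (hb : IsCoeff L C b) (f g : RectL2 L) :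
    ⟪mulL L b f, g⟫_ℝ = ∫ z in rect L, b z * f z * g z := by
  rw [L2.inner_def]
  refine integral_congr_ae ?_
  filter_upwards [mulL_coeFn hb f] with z hz
  simp [hz, mul_comm]

lemma abs_inner_mulL_sub_le {C C' δ : ℝ} {b b' : ℝ × ℝ → ℝ} (hb : IsCoeff L C b)
    (hb' : IsCoeff L C' b') (h : ∀ z ∈ rect L, |b z - b' z| ≤ δ) (f g : RectL2 L) :
    |⟪mulL L b f, g⟫_ℝ - ⟪mulL L b' f, g⟫_ℝ| ≤ δ * ‖f‖ * ‖g‖ := by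
  rw [← inner_sub_left, mulL_sub hb hb']
  exact (abs_real_inner_le_norm _ _).trans
    (mul_le_mul_of_nonneg_right (norm_mulL_le ⟨hb.1.sub hb'.1, h⟩ f) (norm_nonneg _))

/-- The constant function `1` on the rectangle. -/
def oneL (L : ℝ) : RectL2 L := (memLp_const (1 : ℝ)).toLp fun _ => 1

lemma oneL_coeFn : oneL L =ᵐ[volume.restrict (rect L)] fun _ => (1 : ℝ) := MemLp.coeFn_toLp _

lemma inner_oneL (f : RectL2 L) : ⟪oneL L, f⟫_ℝ = ∫ z in rect L, f z := by
  rw [L2.inner_def]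
  refine integral_congr_ae ?_
  filter_upwards [oneL_coeFn (L := L)] with z hz
  simp [hz]

lemma inner_mulL_oneL {C : ℝ} {b : ℝ × ℝ → ℝ} (hb : IsCoeff L C b) (g : RectL2 L) :
    ⟪mulL L b (oneL L), g⟫_ℝ = ∫ z in rect L, b z * g z := by
  rw [inner_mulL hb]
  refine integral_congr_ae ?_
  filter_upwards [oneL_coeFn (L := L)] with z hz
  simp [hz]

/-- The coordinates of a triple. -/
def coord (L : ℝ) (i : Fin 3) : Triple L →L[ℝ] RectL2 L := PiLp.proj 2 _ i

lemma norm_triple_sq (k : Triple L) : ‖k‖ ^ 2 = ‖k 0‖ ^ 2 + ‖k 1‖ ^ 2 + ‖k 2‖ ^ 2 := by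
  rw [PiLp.norm_sq_eq_of_L2, Fin.sum_univ_three]

lemma norm_coord_le (k : Triple L) (i : Fin 3) : ‖k i‖ ≤ ‖k‖ := PiLp.norm_apply_le k i

/-- The triple of the classes of three functions. -/
def mkTriple {u g₁ g₂ : ℝ × ℝ → ℝ} (hu : MemLp u 2 (volume.restrict (rect L)))
    (h₁ : MemLp g₁ 2 (volume.restrict (rect L))) (h₂ : MemLp g₂ 2 (volume.restrict (rect L))) :
    Triple L := WithLp.toLp 2 ![hu.toLp u, h₁.toLp g₁, h₂.toLp g₂]

lemma exists_triple {u g₁ g₂ : ℝ × ℝ → ℝ} (hu : MemLp u 2 (volume.restrict (rect L)))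
    (h₁ : MemLp g₁ 2 (volume.restrict (rect L))) (h₂ : MemLp g₂ 2 (volume.restrict (rect L))) :
    ∃ k : Triple L, k 0 =ᵐ[volume.restrict (rect L)] u ∧
      k 1 =ᵐ[volume.restrict (rect L)] g₁ ∧ k 2 =ᵐ[volume.restrict (rect L)] g₂ :=
  ⟨mkTriple hu h₁ h₂, hu.coeFn_toLp, h₁.coeFn_toLp, h₂.coeFn_toLp⟩

/-- The triples `(φ, ∂₁φ, ∂₂φ)` with `φ` of class `C¹` on the plane. -/
def smoothTriples (L : ℝ) : Submodule ℝ (Triple L) where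
  carrier := {k | ∃ φ : ℝ × ℝ → ℝ, ContDiff ℝ 1 φ ∧ k 0 =ᵐ[volume.restrict (rect L)] φ ∧
    k 1 =ᵐ[volume.restrict (rect L)] (fun z => fderiv ℝ φ z (1, 0)) ∧
    k 2 =ᵐ[volume.restrict (rect L)] fun z => fderiv ℝ φ z (0, 1)}
  add_mem' := by
    rintro k l ⟨φ, hφ, h0, h1, h2⟩ ⟨ψ, hψ, h0', h1', h2'⟩
    have hd : ∀ z, fderiv ℝ (φ + ψ) z = fderiv ℝ φ z + fderiv ℝ ψ z := fun z =>
      fderiv_add (hφ.differentiable one_ne_zero z) (hψ.differentiable one_ne_zero z)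
    refine ⟨φ + ψ, hφ.add hψ, ?_, ?_, ?_⟩
    · filter_upwards [h0, h0', Lp.coeFn_add (k 0) (l 0)] with z e e' e''
      rw [PiLp.add_apply, e'', Pi.add_apply, e, e', Pi.add_apply]
    · filter_upwards [h1, h1', Lp.coeFn_add (k 1) (l 1)] with z e e' e''
      rw [PiLp.add_apply, e'', Pi.add_apply, e, e', hd, _root_.add_apply]
    · filter_upwards [h2, h2', Lp.coeFn_add (k 2) (l 2)] with z e e' e''
      rw [PiLp.add_apply, e'', Pi.add_apply, e, e', hd, _root_.add_apply]
  zero_mem' := by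
    refine ⟨fun _ => 0, contDiff_const, Lp.coeFn_zero _ _ _, ?_, ?_⟩ <;>
    · filter_upwards [Lp.coeFn_zero ℝ 2 (volume.restrict (rect L))] with z e
      simpa using e
  smul_mem' := by
    rintro c k ⟨φ, hφ, h0, h1, h2⟩
    have hd : ∀ z, fderiv ℝ (c • φ) z = c • fderiv ℝ φ z := fun z =>
      fderiv_const_smul (hφ.differentiable one_ne_zero z) c
    refine ⟨c • φ, hφ.const_smul c, ?_, ?_, ?_⟩
    · filter_upwards [h0, Lp.coeFn_smul c (k 0)] with z e e''
      rw [PiLp.smul_apply, e'', Pi.smul_apply, e, Pi.smul_apply]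
    · filter_upwards [h1, Lp.coeFn_smul c (k 1)] with z e e''
      rw [PiLp.smul_apply, e'', Pi.smul_apply, e, hd, _root_.smul_apply]
    · filter_upwards [h2, Lp.coeFn_smul c (k 2)] with z e e''
      rw [PiLp.smul_apply, e'', Pi.smul_apply, e, hd, _root_.smul_apply]

lemma mem_closure_smoothTriples {k : Triple L} :
    k ∈ (smoothTriples L).topologicalClosure ↔ ∃ φ, H1Limit (rect L) φ (k 0) (k 1) (k 2) := by
  have hb := isBounded_rect L
  rw [← SetLike.mem_coe, Submodule.topologicalClosure_coe, mem_closure_iff_seq_limit]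
  constructor
  · rintro ⟨x, hx, ht⟩
    choose φ hφ h0 h1 h2 using hx
    have key : ∀ (i : Fin 3) (f : ℕ → ℝ × ℝ → ℝ), (∀ n, x n i =ᵐ[volume.restrict (rect L)] f n) →
        L2Tendsto (volume.restrict (rect L)) f (k i) := by
      intro i f hf
      have h3 : Tendsto (fun n => x n i) atTop (𝓝 (k i)) :=
        ((coord L i).continuous.tendsto k).comp ht
      refine ((Lp.tendsto_Lp_iff_tendsto_eLpNorm' _ _).1 h3).congr fun n => eLpNorm_congr_ae ?_
      filter_upwards [hf n] with z hz
      simp [hz]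
    exact ⟨φ, hφ, Lp.memLp _, Lp.memLp _, Lp.memLp _, key 0 _ h0, key 1 _ h1, key 2 _ h2⟩
  · rintro ⟨φ, h⟩
    have c0 := h.memLp_approx hb
    have c1 := h.memLp_fderiv_approx hb (1, 0)
    have c2 := h.memLp_fderiv_approx hb (0, 1)
    refine ⟨fun n => mkTriple (c0 n) (c1 n) (c2 n), fun n => ⟨φ n, h.contDiff n,
      (c0 n).coeFn_toLp, (c1 n).coeFn_toLp, (c2 n).coeFn_toLp⟩, ?_⟩
    have t0 := (l2Tendsto_iff_toLp c0 h.memLp).1 h.tendsto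
    have t1 := (l2Tendsto_iff_toLp c1 h.memLp₁).1 h.tendsto₁
    have t2 := (l2Tendsto_iff_toLp c2 h.memLp₂).1 h.tendsto₂
    rw [Lp.toLp_coeFn] at t0 t1 t2
    have ht : Tendsto (fun n => ![(c0 n).toLp _, (c1 n).toLp _, (c2 n).toLp _]) atTop
        (𝓝 (WithLp.ofLp k)) := by
      rw [tendsto_pi_nhds]
      intro i
      fin_cases i
      · exact t0
      · exact t1
      · exact t2
    exact ((PiLp.continuous_toLp 2 _).tendsto _).comp ht

/-- The indicator of the horizontal strip over a set of ordinates. -/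
def strip (S : Set ℝ) : ℝ × ℝ → ℝ := (Prod.snd ⁻¹' S).indicator fun _ => 1

lemma isCoeff_strip {S : Set ℝ} (hS : MeasurableSet S) : IsCoeff L 1 (strip S) := by
  refine ⟨measurable_const.indicator (measurable_snd hS), fun z _ => ?_⟩
  by_cases h : z ∈ Prod.snd ⁻¹' S <;> simp [strip, h]

/-- The `H¹` limits of `C¹` functions on the rectangle with zero mean and equal lateral traces.
Periodicity is encoded by the vanishing of the horizontal integrals of the first derivative,
tested against the indicators of horizontal strips, which makes it a closed condition. -/
def perSpace (L : ℝ) : Submodule ℝ (Triple L) :=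
  (smoothTriples L).topologicalClosure ⊓ (innerSL ℝ (oneL L) ∘L coord L 0).ker ⊓
    ⨅ S : {S : Set ℝ // MeasurableSet S},
      (innerSL ℝ (mulL L (strip S.1) (oneL L)) ∘L coord L 1).ker

lemma isClosed_perSpace : IsClosed (perSpace L : Set (Triple L)) := by
  rw [perSpace, Submodule.coe_inf, Submodule.coe_inf, Submodule.coe_iInf]
  exact ((Submodule.isClosed_topologicalClosure _).inter (ContinuousLinearMap.isClosed_ker _)).inter
    (isClosed_iInter fun S => ContinuousLinearMap.isClosed_ker _)

/-- The horizontal integrals of `g` vanish if and only if `g` is orthogonal to the indicators of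
horizontal strips. -/
lemma ae_integral_eq_zero_iff {g : ℝ × ℝ → ℝ} (hg : MemLp g 2 (volume.restrict (rect L))) :
    (∀ᵐ y ∂(volume.restrict (Ioo (0 : ℝ) 1)), ∫ x in Ioo 0 L, g (x, y) = 0) ↔
      ∀ S : {S : Set ℝ // MeasurableSet S}, ∫ z in rect L, strip S.1 z * g z = 0 := by
  have hi : Integrable g (volume.restrict (rect L)) := hg.integrable (by norm_num)
  have key : ∀ S : {S : Set ℝ // MeasurableSet S}, ∫ z in rect L, strip S.1 z * g z =
      ∫ y in S.1, (∫ x in Ioo 0 L, g (x, y)) ∂(volume.restrict (Ioo (0 : ℝ) 1)) := by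
    intro S
    have hi' : Integrable (fun z => strip S.1 z * g z) (volume.restrict (rect L)) :=
      (memLp_bdd_mul (isCoeff_strip (L := L) S.2).1 (isCoeff_strip S.2).ae_le hg).integrable
        (by norm_num)
    rw [restrict_rect] at hi' ⊢
    rw [integral_prod_symm _ hi', ← integral_indicator S.2]
    refine integral_congr_ae (.of_forall fun y => ?_)
    by_cases h : y ∈ S.1 <;> simp [strip, indicator, h]
  simp_rw [key]
  constructor
  · intro h S
    rw [integral_congr_ae (ae_restrict_of_ae h)]
    simp
  · intro h
    rw [restrict_rect] at hi
    exact hi.integral_prod_right.ae_eq_zero_of_forall_setIntegral_eq_zero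
      fun s hs _ => h ⟨s, hs⟩

lemma mem_perSpace {k : Triple L} : k ∈ perSpace L ↔
    (∃ φ, H1Limit (rect L) φ (k 0) (k 1) (k 2)) ∧ ∫ z in rect L, k 0 z = 0 ∧
      ∀ᵐ y ∂(volume.restrict (Ioo (0 : ℝ) 1)), ∫ x in Ioo 0 L, k 1 (x, y) = 0 := by
  rw [perSpace, Submodule.mem_inf, Submodule.mem_inf, mem_closure_smoothTriples, and_assoc,
    ae_integral_eq_zero_iff (Lp.memLp _)]
  refine and_congr_right fun _ => and_congr ?_ ?_
  · rw [← inner_oneL]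
    rfl
  · rw [Submodule.mem_iInf]
    refine forall_congr' fun S => ?_
    rw [← inner_mulL_oneL (isCoeff_strip S.2)]
    rfl

lemma norm_sq_eq_integral (f : RectL2 L) : ‖f‖ ^ 2 = ∫ z in rect L, f z ^ 2 := by
  rw [← toReal_eLpNorm_two_sq (Lp.memLp f), Lp.norm_def]

lemma L2Tendsto.integral_sq {α : Type*} [MeasurableSpace α] {μ : Measure α} {f : ℕ → α → ℝ}
    {u : α → ℝ} (H : L2Tendsto μ f u) (hf : ∀ n, MemLp (f n) 2 μ) (hu : MemLp u 2 μ) :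
    Tendsto (fun n => ∫ z, f n z ^ 2 ∂μ) atTop (𝓝 (∫ z, u z ^ 2 ∂μ)) := by
  have h := (((l2Tendsto_iff_toLp hf hu).1 H).norm).pow 2
  simpa only [Lp.norm_toLp, toReal_eLpNorm_two_sq (hf _), toReal_eLpNorm_two_sq hu] using h

/-- Poincaré's inequality in `perSpace`. -/
lemma poincare_perSpace (hL : 0 < L) {k : Triple L} (hk : k ∈ perSpace L) :
    ‖k 0‖ ^ 2 ≤ (2 * L ^ 2 + 2) * (‖k 1‖ ^ 2 + ‖k 2‖ ^ 2) := by
  obtain ⟨⟨φ, h⟩, h0, -⟩ := mem_perSpace.1 hk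
  have hb := isBounded_rect L
  have c0 := h.memLp_approx hb
  have c1 := h.memLp_fderiv_approx hb (1, 0)
  have c2 := h.memLp_fderiv_approx hb (0, 1)
  have hm := h.tendsto.integral_mul c0 h.memLp (memLp_const 1)
  simp_rw [mul_one, h0] at hm
  simp_rw [norm_sq_eq_integral]
  have hlim := (((h.tendsto₁.integral_sq c1 h.memLp₁).add
    (h.tendsto₂.integral_sq c2 h.memLp₂)).const_mul (2 * L ^ 2 + 2)).add
    ((hm.pow 2).const_mul L⁻¹)
  rw [zero_pow two_ne_zero, mul_zero, add_zero] at hlim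
  exact le_of_tendsto_of_tendsto' (h.tendsto.integral_sq c0 h.memLp) hlim fun n =>
    poincare_rect hL (h.contDiff n)

end Reference

/-! ### The cell problem transported to the rectangle -/

section CellForm

variable {L G₀ G₁ M : ℝ} {G Ĝ : ℝ → ℝ}

/-- The bilinear form `(k, l) ↦ ∫ b kᵢ lⱼ` on triples. -/
def bil (L : ℝ) (b : ℝ × ℝ → ℝ) (i j : Fin 3) : Triple L →L[ℝ] Triple L →L[ℝ] ℝ :=
  (innerSL ℝ).bilinearComp (mulL L b ∘L coord L i) (coord L j)

lemma bil_apply (b : ℝ × ℝ → ℝ) (i j : Fin 3) (k l : Triple L) :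
    bil L b i j k l = ⟪mulL L b (k i), l j⟫_ℝ := rfl

/-- The slope coefficient `G'(x) y`, the vertical displacement rate of the stretching by `G`. -/
def slope (G : ℝ → ℝ) (z : ℝ × ℝ) : ℝ := deriv G z.1 * z.2

/-- The vertical diffusion coefficient `(1 + (G'(x) y)²) / G(x)`. -/
def vertCoeff (G : ℝ → ℝ) (z : ℝ × ℝ) : ℝ := (slope G z ^ 2 + 1) / G z.1

/-- The Dirichlet form of the cell `Y*(G)`, transported to the rectangle by `(x, y) ↦ (x, G(x) y)`;
see `cellForm_apply`. -/
def cellForm (L : ℝ) (G : ℝ → ℝ) : Triple L →L[ℝ] Triple L →L[ℝ] ℝ :=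
  bil L (fun z => G z.1) 1 1 - bil L (slope G) 1 2 - bil L (slope G) 2 1 + bil L (vertCoeff G) 2 2

/-- The boundary functional `k ↦ -∫₀ᴸ G' k(x, 1) dx`, with the trace on the top side written as
`∫₀¹ (k + y ∂₂k) dy`. -/
def cellFun (L : ℝ) (G : ℝ → ℝ) : Triple L →L[ℝ] ℝ :=
  -(innerSL ℝ (mulL L (fun z => deriv G z.1) (oneL L)) ∘L coord L 0 +
    innerSL ℝ (mulL L (slope G) (oneL L)) ∘L coord L 2)

/-- The functional `k ↦ ∫_{Y*(G)} ∂₁k`, transported to the rectangle. -/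
def fluxFun (L : ℝ) (G : ℝ → ℝ) : Triple L →L[ℝ] ℝ :=
  innerSL ℝ (mulL L (fun z => G z.1) (oneL L)) ∘L coord L 1 -
    innerSL ℝ (mulL L (slope G) (oneL L)) ∘L coord L 2

lemma cellFun_apply (k : Triple L) : cellFun L G k =
    -(⟪mulL L (fun z => deriv G z.1) (oneL L), k 0⟫_ℝ + ⟪mulL L (slope G) (oneL L), k 2⟫_ℝ) := rfl

lemma fluxFun_apply (k : Triple L) : fluxFun L G k =
    ⟪mulL L (fun z => G z.1) (oneL L), k 1⟫_ℝ - ⟪mulL L (slope G) (oneL L), k 2⟫_ℝ := rfl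

lemma pos_of_mem_admissible (hG₀ : 0 < G₀) (hG : G ∈ admissible L G₀ G₁ M) (s : ℝ) : 0 < G s :=
  hG₀.trans_le (hG.2.2.1 s).1

lemma nonneg_of_mem_admissible (hG : G ∈ admissible L G₀ G₁ M) : 0 ≤ M :=
  (abs_nonneg _).trans (hG.2.2.2 0)

lemma isCoeff_profile (hG₀ : 0 < G₀) (hG : G ∈ admissible L G₀ G₁ M) :
    IsCoeff L G₁ fun z => G z.1 :=
  ⟨hG.1.continuous.measurable.comp measurable_fst, fun z _ => by
    rw [abs_of_pos (pos_of_mem_admissible hG₀ hG _)]; exact (hG.2.2.1 _).2⟩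

lemma isCoeff_deriv (hG : G ∈ admissible L G₀ G₁ M) : IsCoeff L M fun z => deriv G z.1 :=
  ⟨(measurable_deriv G).comp measurable_fst, fun _ _ => hG.2.2.2 _⟩

lemma abs_mul_snd_le {a C : ℝ} (ha : |a| ≤ C) {z : ℝ × ℝ} (hz : z ∈ rect L) : |a * z.2| ≤ C := by
  rw [abs_mul, abs_of_pos hz.2.2.1]
  exact (mul_le_of_le_one_right (abs_nonneg _) hz.2.2.2.le).trans ha

lemma isCoeff_slope (hG : G ∈ admissible L G₀ G₁ M) : IsCoeff L M (slope G) :=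
  ⟨((measurable_deriv G).comp measurable_fst).mul measurable_snd,
    fun _ hz => abs_mul_snd_le (hG.2.2.2 _) hz⟩

lemma isCoeff_vertCoeff (hG₀ : 0 < G₀) (hG : G ∈ admissible L G₀ G₁ M) :
    IsCoeff L ((M ^ 2 + 1) / G₀) (vertCoeff G) := by
  refine ⟨(((isCoeff_slope hG).1.pow_const 2).add_const 1).div (isCoeff_profile hG₀ hG).1,
    fun z hz => ?_⟩
  have h1 := (isCoeff_slope hG).2 z hz
  rw [vertCoeff, abs_of_nonneg (div_nonneg (by positivity) (pos_of_mem_admissible hG₀ hG _).le)]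
  refine div_le_div₀ (by positivity) ?_ hG₀ (hG.2.2.1 _).1
  linarith [sq_le_sq' (abs_le.1 h1).1 (abs_le.1 h1).2]

lemma IsCoeff.integrable {C : ℝ} {b : ℝ × ℝ → ℝ} (hb : IsCoeff L C b) (f g : RectL2 L) :
    Integrable (fun z => b z * f z * g z) (volume.restrict (rect L)) :=
  integrable_mul_of_memLp (hb.memLp_mul f) (Lp.memLp g)

/-- The transported Dirichlet form in terms of the transported gradients
`(∂₁k - (G' y / G) ∂₂k, ∂₂k / G)` and the Jacobian `G`. -/
lemma cellForm_apply (hG₀ : 0 < G₀) (hG : G ∈ admissible L G₀ G₁ M) (k l : Triple L) :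
    cellForm L G k l = ∫ z in rect L, G z.1 *
      ((k 1 z - slope G z / G z.1 * k 2 z) * (l 1 z - slope G z / G z.1 * l 2 z) +
        (k 2 z / G z.1) * (l 2 z / G z.1)) := by
  have i1 := isCoeff_profile hG₀ hG
  have i2 := isCoeff_slope hG
  have i3 := isCoeff_vertCoeff hG₀ hG
  have e : cellForm L G k l = ⟪mulL L (fun z => G z.1) (k 1), l 1⟫_ℝ -
      ⟪mulL L (slope G) (k 1), l 2⟫_ℝ - ⟪mulL L (slope G) (k 2), l 1⟫_ℝ +
      ⟪mulL L (vertCoeff G) (k 2), l 2⟫_ℝ := rfl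
  rw [e, inner_mulL i1, inner_mulL i2, inner_mulL i2, inner_mulL i3,
    ← integral_sub' (i1.integrable _ _) (i2.integrable _ _),
    ← integral_sub' ((i1.integrable _ _).sub (i2.integrable _ _)) (i2.integrable _ _),
    ← integral_add' (((i1.integrable _ _).sub (i2.integrable _ _)).sub (i2.integrable _ _))
      (i3.integrable _ _)]
  refine integral_congr_ae (.of_forall fun z => ?_)
  have := (pos_of_mem_admissible hG₀ hG z.1).ne'
  simp only [vertCoeff, Pi.add_apply, Pi.sub_apply]
  field_simp
  ring

/-- Pointwise coercivity of the transported form: `g a` is recovered from `g a - q b` and `b`. -/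
lemma coercive_pointwise {a b q g : ℝ} (hG₀ : 0 < G₀) (hg : G₀ ≤ g) (hg' : g ≤ G₁) (hq : |q| ≤ M) :
    a ^ 2 + b ^ 2 ≤ (((2 + 2 * M ^ 2) / G₀ ^ 2 + 1) * G₁) *
      (g * ((a - q / g * b) * (a - q / g * b) + (b / g) * (b / g))) := by
  have hg0 : 0 < g := hG₀.trans_le hg
  have hq2 : q ^ 2 ≤ M ^ 2 := sq_le_sq' (abs_le.1 hq).1 (abs_le.1 hq).2
  set F := (g * a - q * b) ^ 2 + b ^ 2 with hF
  have e : g * ((a - q / g * b) * (a - q / g * b) + (b / g) * (b / g)) = F / g := by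
    rw [hF]; field_simp
  have hF0 : 0 ≤ F := by positivity
  have h1 : (g * a) ^ 2 ≤ (2 + 2 * M ^ 2) * F := by
    have : q ^ 2 * b ^ 2 ≤ M ^ 2 * b ^ 2 := by gcongr
    nlinarith [sq_nonneg (g * a - q * b - q * b), mul_nonneg (sq_nonneg M)
      (sq_nonneg (g * a - q * b)), sq_nonneg b]
  have h2 : a ^ 2 ≤ (2 + 2 * M ^ 2) / G₀ ^ 2 * F := by
    rw [div_mul_eq_mul_div, le_div_iff₀ (by positivity)]
    have : a ^ 2 * G₀ ^ 2 ≤ a ^ 2 * g ^ 2 := by gcongr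
    nlinarith
  have h3 : F ≤ G₁ * (F / g) := by
    rw [mul_div_assoc', le_div_iff₀ hg0, mul_comm]
    gcongr
  rw [e]
  calc a ^ 2 + b ^ 2 ≤ ((2 + 2 * M ^ 2) / G₀ ^ 2 + 1) * F := by
        have : b ^ 2 ≤ F := by rw [hF]; nlinarith [sq_nonneg (g * a - q * b)]
        linarith
    _ ≤ ((2 + 2 * M ^ 2) / G₀ ^ 2 + 1) * (G₁ * (F / g)) := by gcongr
    _ = _ := by ring

/-- The inverse of the coercivity constant of the transported forms. -/
def coerciveConst (L G₀ G₁ M : ℝ) : ℝ :=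
  (2 * L ^ 2 + 3) * (((2 + 2 * M ^ 2) / G₀ ^ 2 + 1) * G₁)

lemma coerciveConst_pos (hG₀ : 0 < G₀) (hG : G ∈ admissible L G₀ G₁ M) :
    0 < coerciveConst L G₀ G₁ M := by
  have : 0 < G₁ := (pos_of_mem_admissible hG₀ hG 0).trans_le (hG.2.2.1 0).2
  unfold coerciveConst
  positivity

lemma coercive_cellForm (hL : 0 < L) (hG₀ : 0 < G₀) (hG : G ∈ admissible L G₀ G₁ M) :
    ∀ k ∈ perSpace L, (coerciveConst L G₀ G₁ M)⁻¹ * ‖k‖ ^ 2 ≤ cellForm L G k k := by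
  intro k hk
  rw [inv_mul_le_iff₀ (coerciveConst_pos hG₀ hG), coerciveConst, mul_assoc]
  have h1 := poincare_perSpace hL hk
  have h2 : ‖k 1‖ ^ 2 + ‖k 2‖ ^ 2 ≤
      (((2 + 2 * M ^ 2) / G₀ ^ 2 + 1) * G₁) * cellForm L G k k := by
    have i1 := isCoeff_profile hG₀ hG
    have i2 := isCoeff_slope hG
    have i3 := isCoeff_vertCoeff hG₀ hG
    have hint : Integrable (fun z => G z.1 *
      ((k 1 z - slope G z / G z.1 * k 2 z) * (k 1 z - slope G z / G z.1 * k 2 z) +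
        (k 2 z / G z.1) * (k 2 z / G z.1))) (volume.restrict (rect L)) := by
      refine ((((i1.integrable (k 1) (k 1)).sub (i2.integrable (k 1) (k 2))).sub
        (i2.integrable (k 2) (k 1))).add (i3.integrable (k 2) (k 2))).congr
        (.of_forall fun z => ?_)
      have := (pos_of_mem_admissible hG₀ hG z.1).ne'
      simp only [vertCoeff, Pi.add_apply, Pi.sub_apply]
      field_simp
      ring
    rw [cellForm_apply hG₀ hG, norm_sq_eq_integral, norm_sq_eq_integral, ← integral_add
      (Lp.memLp _).integrable_sq (Lp.memLp _).integrable_sq, ← integral_const_mul]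
    refine integral_mono_ae ((Lp.memLp _).integrable_sq.add (Lp.memLp _).integrable_sq)
      (hint.const_mul _) ?_
    filter_upwards [ae_restrict_mem (isOpen_rect L).measurableSet] with z hz
    exact coercive_pointwise hG₀ (hG.2.2.1 _).1 (hG.2.2.1 _).2 (i2.2 z hz)
  rw [norm_triple_sq]
  have h3 : ‖k 0‖ ^ 2 + ‖k 1‖ ^ 2 + ‖k 2‖ ^ 2 ≤
      (2 * L ^ 2 + 3) * (‖k 1‖ ^ 2 + ‖k 2‖ ^ 2) := by linarith
  exact h3.trans (mul_le_mul_of_nonneg_left h2 (by positivity))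

/-- `k` solves the cell problem of `Y*(G)` transported to the rectangle. -/
def IsRefSolution (L : ℝ) (G : ℝ → ℝ) (k : Triple L) : Prop :=
  k ∈ perSpace L ∧ ∀ l ∈ perSpace L, cellForm L G k l = cellFun L G l

lemma exists_isRefSolution (hL : 0 < L) (hG₀ : 0 < G₀) (hG : G ∈ admissible L G₀ G₁ M) :
    ∃ k, IsRefSolution L G k :=
  exists_variational_solution isClosed_perSpace (inv_pos.2 (coerciveConst_pos hG₀ hG))
    (coercive_cellForm hL hG₀ hG) _

lemma IsRefSolution.unique (hL : 0 < L) (hG₀ : 0 < G₀) (hG : G ∈ admissible L G₀ G₁ M)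
    {k k' : Triple L} (hk : IsRefSolution L G k) (hk' : IsRefSolution L G k') : k = k' := by
  have h := norm_variational_solution_sub_le (inv_pos.2 (coerciveConst_pos hG₀ hG))
    (coercive_cellForm hL hG₀ hG) hk.1 hk.2 hk'.1 hk'.2 le_rfl le_rfl (by simp) (by simp)
  simpa [sub_eq_zero] using h

lemma IsRefSolution.norm_le (hL : 0 < L) (hG₀ : 0 < G₀) (hG : G ∈ admissible L G₀ G₁ M)
    {k : Triple L} (hk : IsRefSolution L G k) :
    ‖k‖ ≤ 2 * M * ‖oneL L‖ * coerciveConst L G₀ G₁ M := by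
  have hM := nonneg_of_mem_admissible hG
  have h := norm_variational_solution_le (inv_pos.2 (coerciveConst_pos hG₀ hG))
    (coercive_cellForm hL hG₀ hG) hk.1 hk.2 (Λ := 2 * M * ‖oneL L‖) (by positivity) ?_
  · simpa using h
  · intro l
    rw [cellFun_apply, abs_neg]
    have h1 := (abs_real_inner_le_norm (mulL L (fun z => deriv G z.1) (oneL L)) (l 0)).trans
      (mul_le_mul (norm_mulL_le (isCoeff_deriv hG) _) (norm_coord_le l 0) (norm_nonneg _)
        (by positivity))
    have h2 := (abs_real_inner_le_norm (mulL L (slope G) (oneL L)) (l 2)).trans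
      (mul_le_mul (norm_mulL_le (isCoeff_slope hG) _) (norm_coord_le l 2) (norm_nonneg _)
        (by positivity))
    exact (abs_add_le _ _).trans (by linarith)

variable {δ : ℝ}

lemma abs_slope_sub_le (h' : ∀ s, |deriv G s - deriv Ĝ s| ≤ δ) :
    ∀ z ∈ rect L, |slope G z - slope Ĝ z| ≤ δ := fun z hz => by
  rw [slope, slope, ← sub_mul]
  exact abs_mul_snd_le (h' _) hz

/-- The coefficient `(1 + (G' y)²) / G` is Lipschitz in `G` for the `C¹` norm, since `G ≥ G₀`. -/
lemma abs_vertCoeff_sub_le (hG₀ : 0 < G₀) (hG : G ∈ admissible L G₀ G₁ M)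
    (hĜ : Ĝ ∈ admissible L G₀ G₁ M) (h : ∀ s, |G s - Ĝ s| ≤ δ)
    (h' : ∀ s, |deriv G s - deriv Ĝ s| ≤ δ) :
    ∀ z ∈ rect L, |vertCoeff G z - vertCoeff Ĝ z| ≤
      ((M ^ 2 + 1) / G₀ ^ 2 + 2 * M / G₀) * δ := by
  intro z hz
  have hM := nonneg_of_mem_admissible hG
  have p := pos_of_mem_admissible hG₀ hG z.1
  have p' := pos_of_mem_admissible hG₀ hĜ z.1
  have q := (isCoeff_slope hG).2 z hz
  have q' := (isCoeff_slope hĜ).2 z hz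
  have hδ : 0 ≤ δ := (abs_nonneg _).trans (h 0)
  have e : vertCoeff G z - vertCoeff Ĝ z = (slope G z ^ 2 + 1) * (Ĝ z.1 - G z.1) / (G z.1 * Ĝ z.1) +
      (slope G z + slope Ĝ z) * (slope G z - slope Ĝ z) / Ĝ z.1 := by
    rw [vertCoeff, vertCoeff]
    field_simp
    ring
  have q2 : slope G z ^ 2 ≤ M ^ 2 := sq_le_sq' (abs_le.1 q).1 (abs_le.1 q).2
  rw [e]
  refine (abs_add_le _ _).trans ?_
  rw [add_mul ((M ^ 2 + 1) / G₀ ^ 2)]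
  refine add_le_add ?_ ?_
  · rw [abs_div, abs_mul, abs_of_nonneg (by positivity : 0 ≤ slope G z ^ 2 + 1),
      abs_of_pos (mul_pos p p'), div_mul_eq_mul_div, abs_sub_comm, sq G₀]
    have := h z.1
    have := (hG.2.2.1 z.1).1
    have := (hĜ.2.2.1 z.1).1
    gcongr
  · rw [abs_div, abs_mul, abs_of_pos p', div_mul_eq_mul_div]
    have h1 := abs_slope_sub_le (L := L) h' z hz
    have h2 : |slope G z + slope Ĝ z| ≤ 2 * M :=
      (abs_add_le (slope G z) (slope Ĝ z)).trans (by linarith)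
    have := (hĜ.2.2.1 z.1).1
    gcongr

lemma abs_cellForm_sub_le (hG₀ : 0 < G₀) (hG : G ∈ admissible L G₀ G₁ M)
    (hĜ : Ĝ ∈ admissible L G₀ G₁ M) (h : ∀ s, |G s - Ĝ s| ≤ δ)
    (h' : ∀ s, |deriv G s - deriv Ĝ s| ≤ δ) (k l : Triple L) :
    |cellForm L G k l - cellForm L Ĝ k l| ≤
      (3 + ((M ^ 2 + 1) / G₀ ^ 2 + 2 * M / G₀)) * δ * ‖k‖ * ‖l‖ := by
  have hδ : 0 ≤ δ := (abs_nonneg _).trans (h 0)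
  have hM := nonneg_of_mem_admissible hG
  have key : ∀ {b b' : ℝ × ℝ → ℝ} {C C' η : ℝ} (i j : Fin 3), 0 ≤ η → IsCoeff L C b →
      IsCoeff L C' b' → (∀ z ∈ rect L, |b z - b' z| ≤ η) →
      |bil L b i j k l - bil L b' i j k l| ≤ η * ‖k‖ * ‖l‖ := by
    intro b b' C C' η i j hη hb hb' hd
    rw [bil_apply, bil_apply]
    refine (abs_inner_mulL_sub_le hb hb' hd _ _).trans ?_
    have := norm_coord_le k i
    have := norm_coord_le l j
    gcongr
  have h1 := key 1 1 hδ (isCoeff_profile hG₀ hG) (isCoeff_profile hG₀ hĜ) fun z _ => h z.1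
  have h2 := key 1 2 hδ (isCoeff_slope hG) (isCoeff_slope hĜ) (abs_slope_sub_le h')
  have h3 := key 2 1 hδ (isCoeff_slope hG) (isCoeff_slope hĜ) (abs_slope_sub_le h')
  have h4 := key 2 2 (by positivity) (isCoeff_vertCoeff hG₀ hG) (isCoeff_vertCoeff hG₀ hĜ)
    (abs_vertCoeff_sub_le hG₀ hG hĜ h h')
  simp only [cellForm, _root_.add_apply, _root_.sub_apply]
  rw [abs_le] at *
  constructor <;> linarith [h1.1, h1.2, h2.1, h2.2, h3.1, h3.2, h4.1, h4.2]

lemma abs_inner_mulL_oneL_sub_le {b b' : ℝ × ℝ → ℝ} {C C' : ℝ} (hδ : 0 ≤ δ) (hb : IsCoeff L C b)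
    (hb' : IsCoeff L C' b') (h : ∀ z ∈ rect L, |b z - b' z| ≤ δ) (k : Triple L) (i : Fin 3) :
    |⟪mulL L b (oneL L), k i⟫_ℝ - ⟪mulL L b' (oneL L), k i⟫_ℝ| ≤ δ * ‖oneL L‖ * ‖k‖ :=
  (abs_inner_mulL_sub_le hb hb' h _ _).trans
    (mul_le_mul_of_nonneg_left (norm_coord_le k i) (by positivity))

lemma abs_cellFun_sub_le (hG : G ∈ admissible L G₀ G₁ M)
    (hĜ : Ĝ ∈ admissible L G₀ G₁ M) (h' : ∀ s, |deriv G s - deriv Ĝ s| ≤ δ) (k : Triple L) :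
    |cellFun L G k - cellFun L Ĝ k| ≤ 2 * ‖oneL L‖ * δ * ‖k‖ := by
  have hδ : 0 ≤ δ := (abs_nonneg _).trans (h' 0)
  have h1 := abs_inner_mulL_oneL_sub_le hδ (isCoeff_deriv hG) (isCoeff_deriv hĜ)
    (fun z _ => h' z.1) k 0
  have h2 := abs_inner_mulL_oneL_sub_le hδ (isCoeff_slope hG) (isCoeff_slope hĜ)
    (abs_slope_sub_le h') k 2
  rw [cellFun_apply, cellFun_apply]
  rw [abs_le] at *
  constructor <;> linarith [h1.1, h1.2, h2.1, h2.2]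

lemma abs_fluxFun_sub_le (hG₀ : 0 < G₀) (hG : G ∈ admissible L G₀ G₁ M)
    (hĜ : Ĝ ∈ admissible L G₀ G₁ M) (h : ∀ s, |G s - Ĝ s| ≤ δ)
    (h' : ∀ s, |deriv G s - deriv Ĝ s| ≤ δ) (k : Triple L) :
    |fluxFun L G k - fluxFun L Ĝ k| ≤ 2 * ‖oneL L‖ * δ * ‖k‖ := by
  have hδ : 0 ≤ δ := (abs_nonneg _).trans (h 0)
  have h1 := abs_inner_mulL_oneL_sub_le hδ (isCoeff_profile hG₀ hG) (isCoeff_profile hG₀ hĜ)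
    (fun z _ => h z.1) k 1
  have h2 := abs_inner_mulL_oneL_sub_le hδ (isCoeff_slope hG) (isCoeff_slope hĜ)
    (abs_slope_sub_le h') k 2
  rw [fluxFun_apply, fluxFun_apply]
  rw [abs_le] at *
  constructor <;> linarith [h1.1, h1.2, h2.1, h2.2]

lemma abs_fluxFun_le (hG₀ : 0 < G₀) (hG : G ∈ admissible L G₀ G₁ M) (k : Triple L) :
    |fluxFun L G k| ≤ (G₁ + M) * ‖oneL L‖ * ‖k‖ := by
  have hM := nonneg_of_mem_admissible hG
  have hG₁ : 0 ≤ G₁ := (pos_of_mem_admissible hG₀ hG 0).le.trans (hG.2.2.1 0).2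
  have h1 := (abs_real_inner_le_norm (mulL L (fun z => G z.1) (oneL L)) (k 1)).trans
    (mul_le_mul (norm_mulL_le (isCoeff_profile hG₀ hG) _) (norm_coord_le k 1) (norm_nonneg _)
      (by positivity))
  have h2 := (abs_real_inner_le_norm (mulL L (slope G) (oneL L)) (k 2)).trans
    (mul_le_mul (norm_mulL_le (isCoeff_slope hG) _) (norm_coord_le k 2) (norm_nonneg _)
      (by positivity))
  rw [fluxFun_apply]
  exact (abs_sub _ _).trans (by linarith)

/-- The solutions of the transported problems depend in a Lipschitz way on the profile. -/
lemma exists_norm_sub_le (hL : 0 < L) (hG₀ : 0 < G₀) (G₁ M : ℝ) :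
    ∃ C, 0 ≤ C ∧ ∀ G ∈ admissible L G₀ G₁ M, ∀ Ĝ ∈ admissible L G₀ G₁ M, ∀ δ,
      (∀ s, |G s - Ĝ s| ≤ δ) → (∀ s, |deriv G s - deriv Ĝ s| ≤ δ) →
      ∀ k k', IsRefSolution L G k → IsRefSolution L Ĝ k' → ‖k - k'‖ ≤ C * δ := by
  by_cases hne : ∃ G, G ∈ admissible L G₀ G₁ M
  · obtain ⟨F, hF⟩ := hne
    have hM := nonneg_of_mem_admissible hF
    have hc := coerciveConst_pos hG₀ hF
    refine ⟨(2 * ‖oneL L‖ + (3 + ((M ^ 2 + 1) / G₀ ^ 2 + 2 * M / G₀)) *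
      (2 * M * ‖oneL L‖ * coerciveConst L G₀ G₁ M)) * coerciveConst L G₀ G₁ M, by positivity,
      fun G hG Ĝ hĜ δ h h' k k' hk hk' => ?_⟩
    have hδ : 0 ≤ δ := (abs_nonneg _).trans (h 0)
    refine (norm_variational_solution_sub_le (inv_pos.2 hc) (coercive_cellForm hL hG₀ hG) hk.1 hk.2
      hk'.1 hk'.2 (by positivity) (by positivity) (abs_cellForm_sub_le hG₀ hG hĜ h h')
      (abs_cellFun_sub_le hG hĜ h')).trans ?_
    rw [div_inv_eq_mul]
    have := hk'.norm_le hL hG₀ hĜ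
    calc _ ≤ (2 * ‖oneL L‖ * δ + (3 + ((M ^ 2 + 1) / G₀ ^ 2 + 2 * M / G₀)) * δ *
          (2 * M * ‖oneL L‖ * coerciveConst L G₀ G₁ M)) * coerciveConst L G₀ G₁ M := by gcongr
      _ = _ := by ring
  · exact ⟨0, le_rfl, fun G hG => absurd ⟨G, hG⟩ hne⟩

/-- The area of the cell `Y*(G)`, as an integral over the rectangle. -/
def cellArea (L : ℝ) (G : ℝ → ℝ) : ℝ := ∫ z in rect L, G z.1

lemma cellArea_eq_inner (hG₀ : 0 < G₀) (hG : G ∈ admissible L G₀ G₁ M) :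
    cellArea L G = ⟪mulL L (fun z => G z.1) (oneL L), oneL L⟫_ℝ := by
  rw [inner_mulL_oneL (isCoeff_profile hG₀ hG), cellArea]
  refine integral_congr_ae ?_
  filter_upwards [oneL_coeFn (L := L)] with z hz
  rw [hz, mul_one]

lemma le_cellArea (hL : 0 < L) (hG : G ∈ admissible L G₀ G₁ M) :
    L * G₀ ≤ cellArea L G := by
  have h : ∫ _ in rect L, G₀ = L * G₀ := by
    rw [integral_const, measureReal_rect hL, smul_eq_mul]
  rw [← h]
  have hm : MemLp (fun z : ℝ × ℝ => G z.1) 2 (volume.restrict (rect L)) :=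
    memLp_of_continuous (isBounded_rect L) (hG.1.continuous.comp continuous_fst)
  exact integral_mono (integrable_const _) (hm.integrable (by norm_num)) fun z => (hG.2.2.1 _).1

/-- The effective coefficients of the transported solutions depend in a Lipschitz way on the
profile. -/
lemma exists_abs_fluxFun_div_sub_le (hL : 0 < L) (hG₀ : 0 < G₀) (G₁ M : ℝ) :
    ∃ C, 0 ≤ C ∧ ∀ G ∈ admissible L G₀ G₁ M, ∀ Ĝ ∈ admissible L G₀ G₁ M, ∀ δ,
      (∀ s, |G s - Ĝ s| ≤ δ) → (∀ s, |deriv G s - deriv Ĝ s| ≤ δ) →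
      ∀ k k', IsRefSolution L G k → IsRefSolution L Ĝ k' →
        |fluxFun L G k / cellArea L G - fluxFun L Ĝ k' / cellArea L Ĝ| ≤ C * δ := by
  obtain ⟨C, hC, hCl⟩ := exists_norm_sub_le hL hG₀ G₁ M
  by_cases hne : ∃ G, G ∈ admissible L G₀ G₁ M
  · obtain ⟨F, hF⟩ := hne
    have hM := nonneg_of_mem_admissible hF
    have hc := coerciveConst_pos hG₀ hF
    have hG₁ : 0 ≤ G₁ := (pos_of_mem_admissible hG₀ hF 0).le.trans (hF.2.2.1 0).2
    set N := ‖oneL L‖ with hN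
    set Λ := 2 * M * N * coerciveConst L G₀ G₁ M with hΛ
    have hΛ0 : 0 ≤ Λ := by positivity
    refine ⟨((G₁ + M) * N * C + 2 * N * Λ) / (L * G₀) +
      (G₁ + M) * N * Λ * (N * N) / (L * G₀ * (L * G₀)), by positivity,
      fun G hG Ĝ hĜ δ h h' k k' hk hk' => ?_⟩
    have hδ : 0 ≤ δ := (abs_nonneg _).trans (h 0)
    have hLG : 0 < L * G₀ := by positivity
    have a := le_cellArea hL hG
    have a' := le_cellArea hL hĜ
    have ha := hLG.trans_le a
    have ha' := hLG.trans_le a'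
    have hk'n : ‖k'‖ ≤ Λ := hk'.norm_le hL hG₀ hĜ
    have e : fluxFun L G k / cellArea L G - fluxFun L Ĝ k' / cellArea L Ĝ =
        (fluxFun L G (k - k') + (fluxFun L G k' - fluxFun L Ĝ k')) / cellArea L G +
          fluxFun L Ĝ k' * (cellArea L Ĝ - cellArea L G) / (cellArea L G * cellArea L Ĝ) := by
      rw [map_sub]
      field_simp
      ring
    have h1 : |fluxFun L G (k - k') + (fluxFun L G k' - fluxFun L Ĝ k')| ≤
        ((G₁ + M) * N * C + 2 * N * Λ) * δ := by
      refine (abs_add_le _ _).trans ?_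
      have := (abs_fluxFun_le hG₀ hG (k - k')).trans
        (mul_le_mul_of_nonneg_left (hCl G hG Ĝ hĜ δ h h' k k' hk hk') (by positivity))
      have := (abs_fluxFun_sub_le hG₀ hG hĜ h h' k').trans
        (mul_le_mul_of_nonneg_left hk'n (by positivity))
      linarith
    have h2 : |cellArea L Ĝ - cellArea L G| ≤ N * N * δ := by
      rw [abs_sub_comm, cellArea_eq_inner hG₀ hG, cellArea_eq_inner hG₀ hĜ]
      have := abs_inner_mulL_sub_le (isCoeff_profile hG₀ hG) (isCoeff_profile hG₀ hĜ)
        (fun z _ => h z.1) (oneL L) (oneL L)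
      linarith
    have h3 : |fluxFun L Ĝ k'| ≤ (G₁ + M) * N * Λ :=
      (abs_fluxFun_le hG₀ hĜ k').trans (mul_le_mul_of_nonneg_left hk'n (by positivity))
    rw [e, add_mul, div_mul_eq_mul_div, div_mul_eq_mul_div]
    refine (abs_add_le _ _).trans (add_le_add ?_ ?_)
    · rw [abs_div, abs_of_pos ha]
      gcongr
    · rw [abs_div, abs_mul, abs_of_pos (mul_pos ha ha'), mul_assoc _ (N * N)]
      gcongr
  · exact ⟨0, le_rfl, fun G hG => absurd ⟨G, hG⟩ hne⟩

end CellForm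

/-! ### Functions on a cell and triples on the rectangle -/

section Dictionary

variable {L G₀ G₁ M : ℝ} {G : ℝ → ℝ} {φ : ℕ → ℝ × ℝ → ℝ} {u g₁ g₂ : ℝ × ℝ → ℝ}

lemma cell_mul_one (G : ℝ → ℝ) : cell L (fun s => G s * 1) = cell L G := by simp

lemma cell_inv_mul (hp : ∀ s, 0 < G s) : cell L (fun s => (G s)⁻¹ * G s) = rect L := by
  simp [rect, inv_mul_cancel₀ (hp _).ne']

lemma contDiff_inv (hG : ContDiff ℝ 1 G) (hp : ∀ s, 0 < G s) :
    ContDiff ℝ 1 fun s => (G s)⁻¹ := hG.inv fun s => (hp s).ne'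

lemma deriv_inv_profile (hG : ContDiff ℝ 1 G) (hp : ∀ s, 0 < G s) (s : ℝ) :
    deriv (fun s => (G s)⁻¹) s = -deriv G s / G s ^ 2 :=
  ((hG.differentiable one_ne_zero s).hasDerivAt.fun_inv (hp s).ne').deriv

lemma isBounded_cell_admissible (hG : G ∈ admissible L G₀ G₁ M) :
    Bornology.IsBounded (cell L G) := isBounded_cell fun s => (hG.2.2.1 s).2

lemma isFiniteMeasure_cell (hG : G ∈ admissible L G₀ G₁ M) :
    IsFiniteMeasure ((volume : Measure (ℝ × ℝ)).restrict (cell L G)) :=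
  ⟨by simpa using (isBounded_cell_admissible hG).measure_lt_top⟩

lemma isOpen_cell_admissible (hG : G ∈ admissible L G₀ G₁ M) : IsOpen (cell L G) :=
  isOpen_cell hG.1.continuous

lemma inv_le_inv_profile (hG₀ : 0 < G₀) (hG : G ∈ admissible L G₀ G₁ M) (s : ℝ) :
    G₁⁻¹ ≤ (G s)⁻¹ := inv_anti₀ (pos_of_mem_admissible hG₀ hG s) (hG.2.2.1 s).2

lemma top_pos (hG₀ : 0 < G₀) (hG : G ∈ admissible L G₀ G₁ M) : 0 < G₁ :=
  (pos_of_mem_admissible hG₀ hG 0).trans_le (hG.2.2.1 0).2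

lemma setIntegral_cell_eq (hG₀ : 0 < G₀) (hG : G ∈ admissible L G₀ G₁ M) (f : ℝ × ℝ → ℝ) :
    ∫ z in cell L G, f z = ∫ z in rect L, G z.1 * f (stretch G z) := by
  rw [← setIntegral_cell_stretch hG.1 (pos_of_mem_admissible hG₀ hG) continuous_const,
    cell_mul_one]

lemma ae_rect_of_ae_cell (hG₀ : 0 < G₀) (hG : G ∈ admissible L G₀ G₁ M) {p : ℝ × ℝ → Prop}
    (h : ∀ᵐ z ∂volume.restrict (cell L G), p z) :
    ∀ᵐ z ∂volume.restrict (rect L), p (stretch G z) := by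
  rw [← cell_mul_one] at h
  exact ae_stretch hG.1 hG₀ (fun s => (hG.2.2.1 s).1) continuous_const h

lemma ae_cell_of_ae_rect (hG₀ : 0 < G₀) (hG : G ∈ admissible L G₀ G₁ M) {p : ℝ × ℝ → Prop}
    (h : ∀ᵐ z ∂volume.restrict (rect L), p (stretch G z)) :
    ∀ᵐ z ∂volume.restrict (cell L G), p z := by
  have hp := pos_of_mem_admissible hG₀ hG
  rw [← cell_inv_mul hp] at h
  filter_upwards [ae_stretch (contDiff_inv hG.1 hp) (inv_pos.2 (top_pos hG₀ hG))
    (inv_le_inv_profile hG₀ hG) hG.1.continuous h] with z hz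
  rwa [stretch_stretch_inv hp] at hz

lemma H1Limit.to_rect (hG₀ : 0 < G₀) (hG : G ∈ admissible L G₀ G₁ M)
    (h : H1Limit (cell L G) φ u g₁ g₂) :
    H1Limit (rect L) (fun n z => φ n (stretch G z)) (fun z => u (stretch G z))
      (fun z => g₁ (stretch G z) + slope G z * g₂ (stretch G z))
      (fun z => G z.1 * g₂ (stretch G z)) := by
  rw [← cell_mul_one] at h
  exact h.comp_stretch (C := max G₁ (max M 1)) hG.1 hG₀ (fun s => (hG.2.2.1 s).1)
    (fun s => (hG.2.2.1 s).2.trans (le_max_left _ _))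
    (fun s => (hG.2.2.2 s).trans ((le_max_left _ _).trans (le_max_right _ _))) continuous_const
    (fun s => (le_max_right _ _).trans (le_max_right _ _))

/-- The function on the cell `Y*(G)` given by the function `u` on the rectangle. -/
def toCell (G : ℝ → ℝ) (u : ℝ × ℝ → ℝ) (z : ℝ × ℝ) : ℝ := u (stretch (fun s => (G s)⁻¹) z)

/-- The first partial derivative of `toCell G u`, if `u` has the partial derivatives `g₁`, `g₂`. -/
def toCell₁ (G : ℝ → ℝ) (g₁ g₂ : ℝ × ℝ → ℝ) (z : ℝ × ℝ) : ℝ :=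
  toCell G g₁ z + deriv (fun s => (G s)⁻¹) z.1 * z.2 * toCell G g₂ z

/-- The second partial derivative of `toCell G u`, if `u` has the second partial derivative
`g₂`. -/
def toCell₂ (G : ℝ → ℝ) (g₂ : ℝ × ℝ → ℝ) (z : ℝ × ℝ) : ℝ := (G z.1)⁻¹ * toCell G g₂ z

lemma toCell_stretch (hp : ∀ s, 0 < G s) (u : ℝ × ℝ → ℝ) (z : ℝ × ℝ) :
    toCell G u (stretch G z) = u z := by rw [toCell, stretch_inv_stretch hp]

lemma toCell₁_stretch (hG : ContDiff ℝ 1 G) (hp : ∀ s, 0 < G s) (g₁ g₂ : ℝ × ℝ → ℝ) (z : ℝ × ℝ) :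
    toCell₁ G g₁ g₂ (stretch G z) = g₁ z - slope G z / G z.1 * g₂ z := by
  rw [toCell₁, toCell_stretch hp, toCell_stretch hp, deriv_inv_profile hG hp]
  have := (hp z.1).ne'
  simp only [stretch, slope]
  field_simp
  ring

lemma toCell₂_stretch (hp : ∀ s, 0 < G s) (g₂ : ℝ × ℝ → ℝ) (z : ℝ × ℝ) :
    toCell₂ G g₂ (stretch G z) = g₂ z / G z.1 := by
  rw [toCell₂, toCell_stretch hp, stretch, div_eq_inv_mul]

lemma H1Limit.to_cell (hG₀ : 0 < G₀) (hG : G ∈ admissible L G₀ G₁ M)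
    (h : H1Limit (rect L) φ u g₁ g₂) :
    H1Limit (cell L G) (fun n => toCell G (φ n)) (toCell G u) (toCell₁ G g₁ g₂)
      (toCell₂ G g₂) := by
  have hp := pos_of_mem_admissible hG₀ hG
  rw [← cell_inv_mul hp] at h
  refine h.comp_stretch (C := max G₁ (max (M / G₀ ^ 2) G₀⁻¹)) (contDiff_inv hG.1 hp)
    (inv_pos.2 (top_pos hG₀ hG)) (inv_le_inv_profile hG₀ hG) (fun s => ?_) (fun s => ?_)
    hG.1.continuous (fun s => (hG.2.2.1 s).2.trans (le_max_left _ _))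
  · exact (inv_anti₀ hG₀ (hG.2.2.1 s).1).trans ((le_max_right _ _).trans (le_max_right _ _))
  · refine le_trans ?_ ((le_max_left _ _).trans (le_max_right _ _))
    rw [deriv_inv_profile hG.1 hp, abs_div, abs_neg, abs_of_pos (pow_pos (hp s) 2)]
    have := hG.2.2.2 s
    have := (hG.2.2.1 s).1
    have := nonneg_of_mem_admissible hG
    gcongr

lemma L2Tendsto.add_const {α : Type*} [MeasurableSpace α] {μ : Measure α} {f : ℕ → α → ℝ}
    {v : α → ℝ} (H : L2Tendsto μ f v) (c : ℝ) :
    L2Tendsto μ (fun n z => f n z + c) (fun z => v z + c) := by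
  refine H.congr fun n => ?_
  congr 1
  ext z
  simp

lemma H1Limit.add_const {Ω : Set (ℝ × ℝ)} (hb : Bornology.IsBounded Ω)
    (h : H1Limit Ω φ u g₁ g₂) (c : ℝ) :
    H1Limit Ω (fun n z => φ n z + c) (fun z => u z + c) g₁ g₂ := by
  refine ⟨fun n => (h.contDiff n).add contDiff_const,
    h.memLp.add (memLp_of_continuous hb continuous_const), h.memLp₁, h.memLp₂,
    h.tendsto.add_const c, ?_, ?_⟩
  · simpa only [fderiv_add_const] using h.tendsto₁
  · simpa only [fderiv_add_const] using h.tendsto₂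

/-- The function `V` on the cell `Y*(G)` corresponds to the triple `k` on the rectangle, up to the
additive constant `c`. -/
structure Represents (L : ℝ) (G : ℝ → ℝ) (V : ℝ × ℝ → ℝ) (k : Triple L) (c : ℝ) : Prop where
  memH1 : MemH1 (cell L G) V
  val : ∀ᵐ z ∂volume.restrict (rect L), V (stretch G z) = k 0 z + c
  val₁ : ∀ᵐ z ∂volume.restrict (rect L),
    dOne (cell L G) V (stretch G z) = k 1 z - slope G z / G z.1 * k 2 z
  val₂ : ∀ᵐ z ∂volume.restrict (rect L), dTwo (cell L G) V (stretch G z) = k 2 z / G z.1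

lemma Represents.h1Limit_rect (hG₀ : 0 < G₀) (hG : G ∈ admissible L G₀ G₁ M) {V : ℝ × ℝ → ℝ}
    {k : Triple L} {c : ℝ} (hV : Represents L G V k c)
    (h : H1Limit (cell L G) φ V (dOne (cell L G) V) (dTwo (cell L G) V)) :
    H1Limit (rect L) (fun n z => φ n (stretch G z)) (fun z => k 0 z + c) (k 1) (k 2) := by
  have hp := pos_of_mem_admissible hG₀ hG
  refine (h.to_rect hG₀ hG).congr hV.val ?_ ?_
  · filter_upwards [hV.val₁, hV.val₂] with z h1 h2
    rw [h1, h2]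
    ring
  · filter_upwards [hV.val₂] with z h2
    rw [h2, mul_div_cancel₀ _ (hp z.1).ne']

/-- A triple which is an `H¹` limit of `C¹` functions represents a function on the cell. -/
lemma H1Limit.represents (hG₀ : 0 < G₀) (hG : G ∈ admissible L G₀ G₁ M) {k : Triple L}
    (h : H1Limit (rect L) φ (k 0) (k 1) (k 2)) (c : ℝ) {V : ℝ × ℝ → ℝ}
    (hV : V =ᵐ[volume.restrict (cell L G)] fun z => toCell G (k 0) z + c) :
    H1Limit (cell L G) (fun n z => toCell G (φ n) z + c) V (toCell₁ G (k 1) (k 2))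
      (toCell₂ G (k 2)) ∧ Represents L G V k c := by
  have hp := pos_of_mem_admissible hG₀ hG
  have hb := isBounded_cell_admissible hG
  have ho := isOpen_cell_admissible hG
  have h1 := ((h.to_cell hG₀ hG).add_const hb c).congr hV.symm .rfl .rfl
  refine ⟨h1, h1.memH1 hb, ?_, ?_, ?_⟩
  · filter_upwards [ae_rect_of_ae_cell hG₀ hG hV] with z hz
    rw [hz, toCell_stretch hp]
  · filter_upwards [ae_rect_of_ae_cell hG₀ hG ((h1.weak₁ hb).weakPartial_ae_eq ho)] with z hz
    rw [dOne, hz, toCell₁_stretch hG.1 hp]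
  · filter_upwards [ae_rect_of_ae_cell hG₀ hG ((h1.weak₂ hb).weakPartial_ae_eq ho)] with z hz
    rw [dTwo, hz, toCell₂_stretch hp]

/-! ### Traces on the boundary of a cell -/

lemma map_mul_left_Ioo {a : ℝ} (ha : 0 < a) (b : ℝ) :
    (volume.restrict (Ioo 0 b)).map (a * ·) =
      ENNReal.ofReal a⁻¹ • volume.restrict (Ioo 0 (a * b)) := by
  have hpre : (a * ·) ⁻¹' Ioo 0 (a * b) = Ioo 0 b := by
    ext x
    simp [ha, lt_div_iff₀' ha, mul_lt_mul_iff_right₀ ha]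
  rw [← hpre, ← Measure.restrict_map (measurable_const_mul a) measurableSet_Ioo,
    Real.map_volume_mul_left ha.ne', Measure.restrict_smul, abs_of_pos (inv_pos.2 ha)]

lemma memLp_Ioo_of_continuous {f : ℝ → ℝ} (hf : Continuous f) (b : ℝ) :
    MemLp f 2 (volume.restrict (Ioo 0 b)) :=
  memLp_of_continuous (Metric.isBounded_Ioo 0 b) hf

lemma L2Tendsto.comp_mul_left {f : ℕ → ℝ → ℝ} {t : ℝ → ℝ} {a b : ℝ} (ha : 0 < a)
    (hf : ∀ n, Continuous (f n)) (ht : MemLp t 2 (volume.restrict (Ioo 0 (a * b))))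
    (H : L2Tendsto (volume.restrict (Ioo 0 (a * b))) f t) :
    MemLp (fun s => t (a * s)) 2 (volume.restrict (Ioo 0 b)) ∧
      L2Tendsto (volume.restrict (Ioo 0 b)) (fun n s => f n (a * s)) (fun s => t (a * s)) :=
  ⟨memLp_comp (measurable_const_mul a) ENNReal.ofReal_ne_top (map_mul_left_Ioo ha b).le ht,
    H.comp (measurable_const_mul a) ENNReal.ofReal_ne_top (map_mul_left_Ioo ha b).le
      (fun n => memLp_Ioo_of_continuous (hf n) _) ht⟩

/-- The trace relation in terms of `H1Limit`, for any choice of the weak derivatives. -/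
lemma isTrace_iff {Ω : Set (ℝ × ℝ)} (hΩ : IsOpen Ω) (hb : Bornology.IsBounded Ω) {γ : ℝ → ℝ × ℝ}
    (hγ : Continuous γ) {b : ℝ} {t : ℝ → ℝ} (hu : MemLp u 2 (volume.restrict Ω))
    (h₁ : IsL2WeakPartial Ω (1, 0) u g₁) (h₂ : IsL2WeakPartial Ω (0, 1) u g₂) :
    IsTrace Ω γ (Ioo 0 b) u t ↔ MemLp t 2 (volume.restrict (Ioo 0 b)) ∧
      ∃ φ, H1Limit Ω φ u g₁ g₂ ∧
        L2Tendsto (volume.restrict (Ioo 0 b)) (fun n s => φ n (γ s)) t := by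
  refine and_congr_right fun ht => exists_congr fun φ => ?_
  constructor
  · rintro ⟨hφ, h, h'⟩
    exact ⟨(tendsto_h1Norm_iff hΩ hb hφ hu h₁ h₂).1 h, (l2Tendsto_iff_integral
      (fun n => memLp_Ioo_of_continuous ((hφ n).continuous.comp hγ) b) ht).2 h'⟩
  · rintro ⟨h, h'⟩
    exact ⟨h.contDiff, (tendsto_h1Norm_iff hΩ hb h.contDiff hu h₁ h₂).2 h, (l2Tendsto_iff_integral
      (fun n => memLp_Ioo_of_continuous ((h.contDiff n).continuous.comp hγ) b) ht).1 h'⟩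

lemma MemH1.isTrace_iff {Ω : Set (ℝ × ℝ)} (h : MemH1 Ω u) (hΩ : IsOpen Ω)
    (hb : Bornology.IsBounded Ω) {γ : ℝ → ℝ × ℝ} (hγ : Continuous γ) {b : ℝ} {t : ℝ → ℝ} :
    IsTrace Ω γ (Ioo 0 b) u t ↔ MemLp t 2 (volume.restrict (Ioo 0 b)) ∧
      ∃ φ, H1Limit Ω φ u (dOne Ω u) (dTwo Ω u) ∧
        L2Tendsto (volume.restrict (Ioo 0 b)) (fun n s => φ n (γ s)) t :=
  CellProblem.isTrace_iff hΩ hb hγ h.1 h.dOne_spec h.dTwo_spec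

/-- The top trace of a represented function is the top trace of the triple. -/
lemma Represents.topTrace_ae_eq (hG₀ : 0 < G₀) (hG : G ∈ admissible L G₀ G₁ M) {V : ℝ × ℝ → ℝ}
    {k : Triple L} {c : ℝ} (hV : Represents L G V k c) {v : ℝ → ℝ} (hv : IsTopTrace L G V v) :
    v =ᵐ[volume.restrict (Ioo 0 L)] topTr (fun z => k 0 z + c) (k 2) := by
  obtain ⟨hm, φ, h, ht⟩ := (hV.memH1.isTrace_iff (isOpen_cell_admissible hG)
    (isBounded_cell_admissible hG) (continuous_id.prodMk hG.1.continuous)).1 hv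
  have h' := hV.h1Limit_rect hG₀ hG h
  have ht' := h'.tendsto_topTr
  simp only [stretch, mul_one] at ht'
  exact ht.unique (fun n => memLp_Ioo_of_continuous ((h.contDiff n).continuous.comp
    (continuous_id.prodMk hG.1.continuous)) L) hm (memLp_topTr h'.memLp h'.memLp₂) ht'

/-- Functions of `H(G)` have a trace on the upper boundary. -/
lemma MemH.exists_isTopTrace (hG₀ : 0 < G₀) (hG : G ∈ admissible L G₀ G₁ M) {V : ℝ × ℝ → ℝ}
    (hV : MemH L G V) : ∃ v, IsTopTrace L G V v := by
  obtain ⟨hV1, ⟨t, ht, -⟩, -⟩ := hV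
  have ho := isOpen_cell_admissible hG
  have hb := isBounded_cell_admissible hG
  obtain ⟨-, φ, h, -⟩ := (hV1.isTrace_iff ho hb (by fun_prop)).1 ht
  have h' := h.to_rect hG₀ hG
  have ht' := h'.tendsto_topTr
  simp only [stretch, mul_one] at ht'
  exact ⟨_, (hV1.isTrace_iff ho hb (continuous_id.prodMk hG.1.continuous)).2
    ⟨memLp_topTr h'.memLp h'.memLp₂, φ, h, ht'⟩⟩

/-- Equality of the lateral traces of `V` means that the first partial derivative of the
transported function has vanishing horizontal integrals. -/
lemma ae_integral_eq_zero_of_isTrace (hL : 0 < L) (hG₀ : 0 < G₀) (hG : G ∈ admissible L G₀ G₁ M)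
    {V : ℝ × ℝ → ℝ} (hV1 : MemH1 (cell L G) V) {t : ℝ → ℝ} (htl : IsLeftTrace L G V t)
    (htr : IsRightTrace L G V t) :
    ∀ᵐ y ∂(volume.restrict (Ioo (0 : ℝ) 1)), ∫ x in Ioo 0 L,
      (dOne (cell L G) V (stretch G (x, y)) +
        slope G (x, y) * dTwo (cell L G) V (stretch G (x, y))) = 0 := by
  have hp := pos_of_mem_admissible hG₀ hG
  have ho := isOpen_cell_admissible hG
  have hb := isBounded_cell_admissible hG
  have hGL : G L = G 0 := by simpa using hG.2.1 0
  obtain ⟨hm, φ, h, ht⟩ := (hV1.isTrace_iff ho hb (by fun_prop)).1 htl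
  obtain ⟨-, ψ, h2, ht2⟩ := (hV1.isTrace_iff ho hb (by fun_prop)).1 htr
  have hφ := h.to_rect hG₀ hG
  have hψ := h2.to_rect hG₀ hG
  rw [hGL] at ht2
  rw [← mul_one (G 0)] at hm ht ht2
  have cφ : ∀ n, Continuous fun s : ℝ => φ n (0, s) := fun n =>
    (h.contDiff n).continuous.comp (by fun_prop)
  have cψ : ∀ n, Continuous fun s : ℝ => ψ n (L, s) := fun n =>
    (h2.contDiff n).continuous.comp (by fun_prop)
  obtain ⟨hm', ht'⟩ := ht.comp_mul_left (hp 0) cφ hm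
  obtain ⟨-, ht2'⟩ := ht2.comp_mul_left (hp 0) cψ hm
  have hl := hφ.tendsto_leftTr hL
  have hr := hψ.tendsto_rightTr hL
  simp only [stretch, hGL] at hl hr
  have el := ht'.unique (fun n => memLp_Ioo_of_continuous
    ((cφ n).comp (continuous_const_mul (G 0))) 1) hm' (memLp_leftTr hL hφ.memLp hφ.memLp₁) hl
  have er := ht2'.unique (fun n => memLp_Ioo_of_continuous
    ((cψ n).comp (continuous_const_mul (G 0))) 1) hm' (memLp_rightTr hL hφ.memLp hφ.memLp₁) hr
  filter_upwards [rightTr_sub_leftTr hL hφ.memLp hφ.memLp₁, el, er] with y h4 h5 h6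
  rw [← h4]
  exact sub_eq_zero.2 (h6.symm.trans h5)

/-- Every function of `H(G)` is represented by a triple of `perSpace`. -/
lemma MemH.exists_represents (hL : 0 < L) (hG₀ : 0 < G₀) (hG : G ∈ admissible L G₀ G₁ M)
    {V : ℝ × ℝ → ℝ} (hV : MemH L G V) : ∃ k ∈ perSpace L, ∃ c, Represents L G V k c := by
  obtain ⟨hV1, ⟨t, htl, htr⟩, -⟩ := hV
  have hp := pos_of_mem_admissible hG₀ hG
  obtain ⟨-, φ, h, -⟩ := (hV1.isTrace_iff (isOpen_cell_admissible hG)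
    (isBounded_cell_admissible hG) (by fun_prop)).1 htl
  have hφ := h.to_rect hG₀ hG
  have hper := ae_integral_eq_zero_of_isTrace hL hG₀ hG hV1 htl htr
  obtain ⟨c, hc⟩ : ∃ c, c = L⁻¹ * ∫ z in rect L, V (stretch G z) := ⟨_, rfl⟩
  have h3 := hφ.add_const (isBounded_rect L) (-c)
  obtain ⟨k, k0, k1, k2⟩ := exists_triple h3.memLp h3.memLp₁ h3.memLp₂
  have hmean : ∫ z in rect L, k 0 z = 0 := by
    rw [integral_congr_ae k0, integral_add (hφ.memLp.integrable (by norm_num))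
      (integrable_const _), integral_const, measureReal_rect hL, hc, smul_eq_mul]
    field_simp
    ring
  have hper' : ∀ᵐ y ∂(volume.restrict (Ioo (0 : ℝ) 1)), ∫ x in Ioo 0 L, k 1 (x, y) = 0 := by
    rw [ae_integral_eq_zero_iff (Lp.memLp _)]
    intro S
    rw [← (ae_integral_eq_zero_iff h3.memLp₁).1 hper S]
    exact integral_congr_ae (by filter_upwards [k1] with z hz; rw [hz])
  refine ⟨k, mem_perSpace.2 ⟨⟨_, h3.congr k0.symm k1.symm k2.symm⟩, hmean, hper'⟩,
    c, hV1, ?_, ?_, ?_⟩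
  · filter_upwards [k0] with z hz
    rw [hz]; ring
  · filter_upwards [k1, k2] with z hz hz'
    have := (hp z.1).ne'
    rw [hz, hz']
    field_simp
    ring
  · filter_upwards [k2] with z hz'
    have := (hp z.1).ne'
    rw [hz']
    field_simp

/-- A triple of `perSpace` represents a function of `H(G)`, once the mean over the cell is
removed. -/
lemma memH_toCell (hL : 0 < L) (hG₀ : 0 < G₀) (hG : G ∈ admissible L G₀ G₁ M) {k : Triple L}
    (hk : k ∈ perSpace L) {c : ℝ} (hc : ∫ z in cell L G, (toCell G (k 0) z + c) = 0) :
    MemH L G fun z => toCell G (k 0) z + c := by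
  obtain ⟨⟨φ, h⟩, -, hper⟩ := mem_perSpace.1 hk
  have hp := pos_of_mem_admissible hG₀ hG
  have ho := isOpen_cell_admissible hG
  have hb := isBounded_cell_admissible hG
  have hGL : G L = G 0 := by simpa using hG.2.1 0
  obtain ⟨h1, hV⟩ := h.represents hG₀ hG c .rfl
  have hone : (G 0)⁻¹ * G 0 = 1 := inv_mul_cancel₀ (hp 0).ne'
  have ml := memLp_leftTr hL h.memLp h.memLp₁
  have tl := h.tendsto_leftTr hL
  have tr : L2Tendsto (volume.restrict (Ioo 0 1)) (fun n y => φ n (L, y))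
      (leftTr L (k 0) (k 1)) := by
    refine (h.tendsto_rightTr hL).congr fun n => eLpNorm_congr_ae ?_
    filter_upwards [rightTr_sub_leftTr hL h.memLp h.memLp₁, hper] with y h4 h5
    rw [h5, sub_eq_zero] at h4
    simp [h4]
  rw [← hone] at ml tl tr
  obtain ⟨ml', tl'⟩ := tl.comp_mul_left (inv_pos.2 (hp 0))
    (fun n => (h.contDiff n).continuous.comp (by fun_prop)) ml
  obtain ⟨-, tr'⟩ := tr.comp_mul_left (inv_pos.2 (hp 0))
    (fun n => (h.contDiff n).continuous.comp (by fun_prop)) ml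
  have ml'' : MemLp (fun s => leftTr L (k 0) (k 1) ((G 0)⁻¹ * s) + c) 2
      (volume.restrict (Ioo 0 (G 0))) := ml'.add (memLp_const c)
  refine ⟨hV.memH1, ⟨fun s => leftTr L (k 0) (k 1) ((G 0)⁻¹ * s) + c, ?_, ?_⟩, hc⟩
  · exact (isTrace_iff ho hb (by fun_prop) h1.memLp (h1.weak₁ hb) (h1.weak₂ hb)).2
      ⟨ml'', _, h1, tl'.add_const c⟩
  · refine (isTrace_iff ho hb (by fun_prop) h1.memLp (h1.weak₁ hb) (h1.weak₂ hb)).2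
      ⟨by rwa [hGL], _, h1, ?_⟩
    have := tr'.add_const c
    simp only [toCell, stretch, hGL]
    exact this

end Dictionary

/-! ### Cell solutions and solutions on the rectangle -/

section Solutions

variable {L G₀ G₁ M : ℝ} {G Ĝ : ℝ → ℝ} {X V : ℝ × ℝ → ℝ} {k l : Triple L} {c d : ℝ}

lemma Represents.setIntegral_grad (hG₀ : 0 < G₀) (hG : G ∈ admissible L G₀ G₁ M)
    (hX : Represents L G X k c) (hV : Represents L G V l d) :
    ∫ z in cell L G, (dOne (cell L G) X z * dOne (cell L G) V z +
      dTwo (cell L G) X z * dTwo (cell L G) V z) = cellForm L G k l := by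
  rw [setIntegral_cell_eq hG₀ hG, cellForm_apply hG₀ hG]
  refine integral_congr_ae ?_
  filter_upwards [hX.val₁, hX.val₂, hV.val₁, hV.val₂] with z h1 h2 h3 h4
  rw [h1, h2, h3, h4]

lemma integral_deriv_profile (hL : 0 < L) (hG : G ∈ admissible L G₀ G₁ M) :
    ∫ z in rect L, deriv G z.1 = 0 := by
  rw [restrict_rect, integral_fun_fst (fun x => deriv G x), ← integral_Ioc_eq_integral_Ioo,
    ← intervalIntegral.integral_of_le hL.le, intervalIntegral.integral_deriv_eq_sub
      (fun x _ => hG.1.differentiable one_ne_zero x)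
      ((hG.1.continuous_deriv le_rfl).intervalIntegrable _ _)]
  have hGL : G L = G 0 := by simpa using hG.2.1 0
  simp [hGL]

lemma setIntegral_rect {f : ℝ × ℝ → ℝ} (hf : Integrable f (volume.restrict (rect L))) :
    ∫ z in rect L, f z = ∫ x in Ioo 0 L, ∫ y in Ioo 0 1, f (x, y) := by
  rw [restrict_rect] at hf ⊢
  exact integral_prod _ hf

/-- The boundary integral of the cell problem; the additive constant does not contribute since
`G` is periodic. -/
lemma Represents.boundary_integral (hL : 0 < L) (hG₀ : 0 < G₀) (hG : G ∈ admissible L G₀ G₁ M)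
    (hV : Represents L G V l d) {v : ℝ → ℝ} (hv : IsTopTrace L G V v) :
    -∫ s in Ioo 0 L, deriv G s / √(1 + deriv G s ^ 2) * v s * √(1 + deriv G s ^ 2) =
      cellFun L G l := by
  have i1 := isCoeff_deriv hG
  have i2 := isCoeff_slope hG
  have m0 := (i1.memLp_mul (l 0)).integrable (μ := volume.restrict (rect L)) (by norm_num)
  have m2 := (i2.memLp_mul (l 2)).integrable (μ := volume.restrict (rect L)) (by norm_num)
  have mc : Integrable (fun z : ℝ × ℝ => d * deriv G z.1) (volume.restrict (rect L)) :=
    (memLp_of_continuous (μ := volume) (isBounded_rect L) (continuous_const.mul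
      ((hG.1.continuous_deriv le_rfl).comp continuous_fst))).integrable (by norm_num)
  have e1 : ∫ s in Ioo 0 L, deriv G s / √(1 + deriv G s ^ 2) * v s * √(1 + deriv G s ^ 2) =
      ∫ x in Ioo 0 L, ∫ y in Ioo 0 1,
        (deriv G x * l 0 (x, y) + d * deriv G x + slope G (x, y) * l 2 (x, y)) := by
    refine integral_congr_ae ?_
    filter_upwards [hV.topTrace_ae_eq hG₀ hG hv] with x hx
    have hs : √(1 + deriv G x ^ 2) ≠ 0 := (Real.sqrt_pos.2 (by positivity)).ne'
    rw [hx, div_mul_eq_mul_div, div_mul_cancel₀ _ hs, topTr, ← integral_const_mul]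
    refine integral_congr_ae (.of_forall fun y => ?_)
    simp only [slope]
    ring
  have hi := (m0.add mc).add m2
  rw [e1, cellFun_apply, inner_mulL_oneL i1, inner_mulL_oneL i2]
  have e2 : ∫ z in rect L, (deriv G z.1 * l 0 z + d * deriv G z.1 + slope G z * l 2 z) =
      (∫ z in rect L, deriv G z.1 * l 0 z) + ∫ z in rect L, slope G z * l 2 z := by
    rw [integral_add (f := fun z => deriv G z.1 * l 0 z + d * deriv G z.1) (m0.add mc) m2,
      integral_add m0 mc, integral_const_mul, integral_deriv_profile hL hG, mul_zero, add_zero]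
  rw [← e2]
  exact congrArg Neg.neg (setIntegral_rect hi).symm

/-- A function of `H(G)` solves the cell problem exactly when the triple which represents it solves
the transported problem. -/
lemma Represents.isCellSolution_iff (hL : 0 < L) (hG₀ : 0 < G₀) (hG : G ∈ admissible L G₀ G₁ M)
    (hXH : MemH L G X) (hk : k ∈ perSpace L) (hX : Represents L G X k c) :
    IsCellSolution L G X ↔ IsRefSolution L G k := by
  constructor
  · rintro ⟨-, h⟩
    refine ⟨hk, fun l hl => ?_⟩
    obtain ⟨⟨φ, hφ⟩, -⟩ := mem_perSpace.1 hl
    have hfin := isFiniteMeasure_cell hG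
    -- The additive constant is minus the mean over the cell.
    obtain ⟨d, hd⟩ : ∃ d, d = -⨍ z in cell L G, toCell G (l 0) z := ⟨_, rfl⟩
    have hmean : ∫ z in cell L G, (toCell G (l 0) z + d) = 0 := by
      simp_rw [hd, ← sub_eq_add_neg]
      exact integral_sub_average _ _
    have hV := (hφ.represents hG₀ hG d .rfl).2
    have hVH := memH_toCell hL hG₀ hG hl hmean
    obtain ⟨v, hv⟩ := hVH.exists_isTopTrace hG₀ hG
    rw [← hX.setIntegral_grad hG₀ hG hV, ← hV.boundary_integral hL hG₀ hG hv]
    exact h _ hVH v hv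
  · rintro ⟨-, h⟩
    refine ⟨hXH, fun V hV v hv => ?_⟩
    obtain ⟨l, hl, d, hr⟩ := hV.exists_represents hL hG₀ hG
    rw [hX.setIntegral_grad hG₀ hG hr, hr.boundary_integral hL hG₀ hG hv]
    exact h l hl

lemma exists_isCellSolution (hL : 0 < L) (hG₀ : 0 < G₀) (hG : G ∈ admissible L G₀ G₁ M) :
    ∃ X, IsCellSolution L G X := by
  obtain ⟨k, hk⟩ := exists_isRefSolution hL hG₀ hG
  obtain ⟨⟨φ, hφ⟩, -⟩ := mem_perSpace.1 hk.1
  have hfin := isFiniteMeasure_cell hG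
  obtain ⟨d, hd⟩ : ∃ d, d = -⨍ z in cell L G, toCell G (k 0) z := ⟨_, rfl⟩
  have hmean : ∫ z in cell L G, (toCell G (k 0) z + d) = 0 := by
    simp_rw [hd, ← sub_eq_add_neg]
    exact integral_sub_average _ _
  exact ⟨_, ((hφ.represents hG₀ hG d .rfl).2.isCellSolution_iff hL hG₀ hG
    (memH_toCell hL hG₀ hG hk.1 hmean) hk.1).2 hk⟩

lemma isCellSolution_cellSolution (hL : 0 < L) (hG₀ : 0 < G₀) (hG : G ∈ admissible L G₀ G₁ M) :
    IsCellSolution L G (cellSolution L G) :=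
  Classical.epsilon_spec (exists_isCellSolution hL hG₀ hG)

lemma IsCellSolution.exists_represents (hL : 0 < L) (hG₀ : 0 < G₀)
    (hG : G ∈ admissible L G₀ G₁ M) (hX : IsCellSolution L G X) :
    ∃ k, IsRefSolution L G k ∧ ∃ c, Represents L G X k c := by
  obtain ⟨k, hk, c, h⟩ := hX.1.exists_represents hL hG₀ hG
  exact ⟨k, (h.isCellSolution_iff hL hG₀ hG hX.1 hk).1 hX, c, h⟩

lemma measureReal_cell (hG₀ : 0 < G₀) (hG : G ∈ admissible L G₀ G₁ M) :
    volume.real (cell L G) = cellArea L G := by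
  have h := setIntegral_cell_eq hG₀ hG fun _ => 1
  simpa [cellArea] using h

lemma IsCellSolution.ae_eq (hL : 0 < L) (hG₀ : 0 < G₀) (hG : G ∈ admissible L G₀ G₁ M)
    {Y : ℝ × ℝ → ℝ} (hX : IsCellSolution L G X) (hY : IsCellSolution L G Y) :
    X =ᵐ[volume.restrict (cell L G)] Y := by
  obtain ⟨k, hk, c, hr⟩ := hX.exists_represents hL hG₀ hG
  obtain ⟨k', hk', c', hr'⟩ := hY.exists_represents hL hG₀ hG
  obtain rfl := hk.unique hL hG₀ hG hk'
  have hfin := isFiniteMeasure_cell hG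
  have h1 : ∀ᵐ z ∂volume.restrict (cell L G), X z = Y z + (c - c') := by
    refine ae_cell_of_ae_rect hG₀ hG ?_
    filter_upwards [hr.val, hr'.val] with z h h'
    rw [h, h']
    ring
  -- Both functions have zero mean, so the difference of the two constants vanishes.
  have h2 := integral_congr_ae h1
  rw [integral_add (hY.1.1.1.integrable (by norm_num)) (integrable_const _), hX.1.2.2, hY.1.2.2,
    integral_const, zero_add, smul_eq_mul, measureReal_restrict_apply_univ,
    measureReal_cell hG₀ hG] at h2
  have hA : 0 < cellArea L G := (by positivity : 0 < L * G₀).trans_le (le_cellArea hL hG)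
  have h3 : c - c' = 0 := (mul_eq_zero.1 h2.symm).resolve_left hA.ne'
  filter_upwards [h1] with z hz
  rw [hz, h3, add_zero]

/-! ### Comparison of two profiles -/

lemma setIntegral_sq_toCell_le (hG₀ : 0 < G₀) (hG : G ∈ admissible L G₀ G₁ M) (f : RectL2 L) :
    ∫ z in cell L G, toCell G f z ^ 2 ≤ G₁ * ‖f‖ ^ 2 := by
  have hp := pos_of_mem_admissible hG₀ hG
  rw [setIntegral_cell_eq hG₀ hG, norm_sq_eq_integral, ← integral_const_mul]
  simp_rw [toCell_stretch hp]
  refine integral_mono_of_nonneg (.of_forall fun z => mul_nonneg (hp _).le (sq_nonneg _))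
    ((Lp.memLp f).integrable_sq.const_mul _) (.of_forall fun z => ?_)
  exact mul_le_mul_of_nonneg_right (hG.2.2.1 _).2 (sq_nonneg _)

lemma cellForm_self_le (hG₀ : 0 < G₀) (hG : G ∈ admissible L G₀ G₁ M) (k : Triple L) :
    cellForm L G k k ≤ (G₁ + 2 * M + (M ^ 2 + 1) / G₀) * ‖k‖ ^ 2 := by
  have hM := nonneg_of_mem_admissible hG
  have hG₁ := (top_pos hG₀ hG).le
  have key : ∀ {b : ℝ × ℝ → ℝ} {C : ℝ} (i j : Fin 3), 0 ≤ C → IsCoeff L C b →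
      |bil L b i j k k| ≤ C * ‖k‖ ^ 2 := by
    intro b C i j hC hb
    rw [bil_apply]
    refine (abs_real_inner_le_norm _ _).trans ?_
    have h1 := norm_mulL_le hb (k i)
    have h2 := norm_coord_le k i
    have h3 := norm_coord_le k j
    calc _ ≤ (C * ‖k‖) * ‖k‖ := by gcongr; exact h1.trans (by gcongr)
      _ = _ := by ring
  have h1 := key 1 1 hG₁ (isCoeff_profile hG₀ hG)
  have h2 := key 1 2 hM (isCoeff_slope hG)
  have h3 := key 2 1 hM (isCoeff_slope hG)
  have h4 := key 2 2 (by positivity) (isCoeff_vertCoeff hG₀ hG)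
  simp only [cellForm, _root_.add_apply, _root_.sub_apply]
  linarith [(abs_le.1 h1).2, (abs_le.1 h2).1, (abs_le.1 h3).1, (abs_le.1 h4).2]

/-- The `H¹` norm on the cell of a function with zero mean is controlled by the norm of the triple
which represents it. -/
lemma Represents.h1Norm_le (hG₀ : 0 < G₀) (hG : G ∈ admissible L G₀ G₁ M)
    (hV : Represents L G V k c) (hmean : ∫ z in cell L G, V z = 0) :
    h1Norm (cell L G) V ≤ √(2 * G₁ + 2 * M + (M ^ 2 + 1) / G₀) * ‖k‖ := by
  have hp := pos_of_mem_admissible hG₀ hG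
  have hfin := isFiniteMeasure_cell hG
  have hVi := hV.memH1.1.integrable (by norm_num)
  have i1 := hV.memH1.dOne_spec.1.integrable_sq
  have i2 := hV.memH1.dTwo_spec.1.integrable_sq
  have hval : ∀ᵐ z ∂volume.restrict (cell L G), V z - c = toCell G (k 0) z := by
    refine ae_cell_of_ae_rect hG₀ hG ?_
    filter_upwards [hV.val] with z hz
    rw [hz, toCell_stretch hp]
    ring
  have h0 : ∫ z in cell L G, V z ^ 2 ≤ G₁ * ‖k 0‖ ^ 2 := by
    refine le_trans ?_ (setIntegral_sq_toCell_le hG₀ hG (k 0))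
    have e : ∫ z in cell L G, toCell G (k 0) z ^ 2 =
        (∫ z in cell L G, V z ^ 2) + c ^ 2 * volume.real (cell L G) := by
      have e1 : ∫ z in cell L G, toCell G (k 0) z ^ 2 =
          ∫ z in cell L G, (V z ^ 2 - 2 * c * V z + c ^ 2) := by
        refine integral_congr_ae ?_
        filter_upwards [hval] with z hz
        rw [← hz]
        ring
      rw [e1, integral_add (f := fun z => V z ^ 2 - 2 * c * V z)
        (hV.memH1.1.integrable_sq.sub (hVi.const_mul _)) (integrable_const _),
        integral_sub hV.memH1.1.integrable_sq (hVi.const_mul _), integral_const_mul, hmean,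
        integral_const, measureReal_restrict_apply_univ, smul_eq_mul]
      ring
    rw [e]
    have : 0 ≤ c ^ 2 * volume.real (cell L G) := by positivity
    linarith
  have h1 : (∫ z in cell L G, dOne (cell L G) V z ^ 2) + ∫ z in cell L G, dTwo (cell L G) V z ^ 2 =
      cellForm L G k k := by
    rw [← hV.setIntegral_grad hG₀ hG hV, ← integral_add i1 i2]
    simp_rw [sq]
  rw [h1Norm_eq (isOpen_cell_admissible hG) hV.memH1.1 hV.memH1.dOne_spec hV.memH1.dTwo_spec,
    add_assoc, h1]
  refine Real.sqrt_le_iff.2 ⟨by positivity, ?_⟩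
  have hM := nonneg_of_mem_admissible hG
  have hG₁ := (top_pos hG₀ hG).le
  rw [mul_pow, Real.sq_sqrt (by positivity)]
  have h2 := cellForm_self_le hG₀ hG k
  have h3 : G₁ * ‖k 0‖ ^ 2 ≤ G₁ * ‖k‖ ^ 2 := by
    have := norm_coord_le k 0
    gcongr
  linarith

lemma cellMap_stretch (hp : ∀ s, 0 < G s) (z : ℝ × ℝ) :
    cellMap G Ĝ (stretch G z) = stretch Ĝ z := by
  have := (hp z.1).ne'
  simp only [cellMap, stretch, Prod.mk.injEq, true_and]
  field_simp

/-- The function `U(Ĝ)` on `Y*(G)` corresponds to the same triple as `X(Ĝ)` on `Y*(Ĝ)`. -/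
lemma pulledSolution_ae_eq (hG₀ : 0 < G₀) (hG : G ∈ admissible L G₀ G₁ M)
    (h : Represents L Ĝ (cellSolution L Ĝ) k c) :
    ∃ d, pulledSolution L G Ĝ =ᵐ[volume.restrict (cell L G)] fun z => toCell G (k 0) z + d := by
  have hp := pos_of_mem_admissible hG₀ hG
  refine ⟨c - ⨍ w in cell L G, cellSolution L Ĝ (cellMap G Ĝ w), ae_cell_of_ae_rect hG₀ hG ?_⟩
  filter_upwards [h.val] with z hz
  rw [pulledSolution, cellMap_stretch hp, hz, toCell_stretch hp]
  ring

lemma Represents.effCoeff_eq (hL : 0 < L) (hG₀ : 0 < G₀) (hG : G ∈ admissible L G₀ G₁ M)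
    (h : Represents L G (cellSolution L G) k c) :
    effCoeff L G = 1 - fluxFun L G k / cellArea L G := by
  have i1 := isCoeff_profile hG₀ hG
  have i2 := isCoeff_slope hG
  have hfin := isFiniteMeasure_cell hG
  have hA : 0 < cellArea L G := (by positivity : 0 < L * G₀).trans_le (le_cellArea hL hG)
  have e : ∫ z in cell L G, dOne (cell L G) (cellSolution L G) z = fluxFun L G k := by
    rw [setIntegral_cell_eq hG₀ hG, fluxFun_apply, inner_mulL_oneL i1, inner_mulL_oneL i2,
      ← integral_sub ((i1.memLp_mul _).integrable (by norm_num))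
      ((i2.memLp_mul _).integrable (by norm_num))]
    refine integral_congr_ae ?_
    filter_upwards [h.val₁] with z hz
    have := (pos_of_mem_admissible hG₀ hG z.1).ne'
    rw [hz]
    field_simp
  rw [effCoeff, setAverage_eq, integral_sub (integrable_const _)
    (h.memH1.dOne_spec.1.integrable (by norm_num)), e, integral_const,
    measureReal_restrict_apply_univ, measureReal_cell hG₀ hG, smul_eq_mul, smul_eq_mul]
  field_simp

/-- The suprema in `c1Norm` are taken over bounded families for admissible profiles, so they bound
the values. -/
lemma le_of_c1Norm_le {δ : ℝ} (hG₀ : 0 < G₀) (hG : G ∈ admissible L G₀ G₁ M)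
    (hĜ : Ĝ ∈ admissible L G₀ G₁ M) (h : c1Norm (fun s => G s - Ĝ s) ≤ δ) :
    (∀ s, |G s - Ĝ s| ≤ δ) ∧ ∀ s, |deriv G s - deriv Ĝ s| ≤ δ := by
  have hd : ∀ s, deriv (fun s => G s - Ĝ s) s = deriv G s - deriv Ĝ s := fun s =>
    deriv_fun_sub (hG.1.differentiable one_ne_zero s) (hĜ.1.differentiable one_ne_zero s)
  simp only [c1Norm, hd] at h
  have b1 : BddAbove (range fun s => |G s - Ĝ s|) := by
    refine ⟨2 * G₁, ?_⟩
    rintro _ ⟨s, rfl⟩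
    rw [abs_le]
    constructor <;> linarith [(hG.2.2.1 s).1, (hG.2.2.1 s).2, (hĜ.2.2.1 s).1, (hĜ.2.2.1 s).2]
  have b2 : BddAbove (range fun s => |deriv G s - deriv Ĝ s|) := by
    refine ⟨2 * M, ?_⟩
    rintro _ ⟨s, rfl⟩
    refine (abs_sub _ _).trans ?_
    linarith [hG.2.2.2 s, hĜ.2.2.2 s]
  have n1 : 0 ≤ ⨆ s, |G s - Ĝ s| := Real.iSup_nonneg fun _ => abs_nonneg _
  have n2 : 0 ≤ ⨆ s, |deriv G s - deriv Ĝ s| := Real.iSup_nonneg fun _ => abs_nonneg _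
  exact ⟨fun s => (le_ciSup b1 s).trans (by linarith), fun s => (le_ciSup b2 s).trans (by linarith)⟩

end Solutions

end CellProblem

end

open CellProblem
theorem propositionA1 (L G₀ G₁ M : ℝ) (hL : 0 < L) (hG₀ : 0 < G₀) :
    (∀ G ∈ admissible L G₀ G₁ M,
      IsCellSolution L G (cellSolution L G) ∧
      ∀ X, IsCellSolution L G X →
        X =ᵐ[volume.restrict (cell L G)] cellSolution L G) ∧
    ∀ ε : ℝ, 0 < ε → ∃ δ : ℝ, 0 < δ ∧
      ∀ G ∈ admissible L G₀ G₁ M, ∀ Ĝ ∈ admissible L G₀ G₁ M,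
        c1Norm (fun s => G s - Ĝ s) ≤ δ →
          (MemH1 (cell L G) (pulledSolution L G G) ∧
            MemH1 (cell L G) (pulledSolution L G Ĝ) ∧
            h1Norm (cell L G)
              (fun z => pulledSolution L G G z - pulledSolution L G Ĝ z) ≤ ε) ∧
          |effCoeff L G - effCoeff L Ĝ| ≤ ε := by
  refine ⟨fun G hG => ⟨isCellSolution_cellSolution hL hG₀ hG, fun X hX =>
    hX.ae_eq hL hG₀ hG (isCellSolution_cellSolution hL hG₀ hG)⟩, fun ε hε => ?_⟩
  obtain ⟨C, hC, hCk⟩ := exists_norm_sub_le hL hG₀ G₁ M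
  obtain ⟨D, hD, hDr⟩ := exists_abs_fluxFun_div_sub_le hL hG₀ G₁ M
  set K := √(2 * G₁ + 2 * M + (M ^ 2 + 1) / G₀) with hK
  have hK0 : 0 ≤ K := Real.sqrt_nonneg _
  refine ⟨ε / (K * C + D + 1), by positivity, fun G hG Ĝ hĜ hle => ?_⟩
  obtain ⟨h0, h1⟩ := le_of_c1Norm_le hG₀ hG hĜ hle
  set δ := ε / (K * C + D + 1) with hδ
  have hδ0 : 0 < δ := by positivity
  have hδε : (K * C + D + 1) * δ = ε := mul_div_cancel₀ _ (by positivity)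
  obtain ⟨k, hk, c, hr⟩ := (isCellSolution_cellSolution hL hG₀ hG).exists_represents hL hG₀ hG
  obtain ⟨k', hk', c', hr'⟩ := (isCellSolution_cellSolution hL hG₀ hĜ).exists_represents hL hG₀ hĜ
  obtain ⟨d, hd⟩ := pulledSolution_ae_eq hG₀ hG hr
  obtain ⟨d', hd'⟩ := pulledSolution_ae_eq hG₀ hG hr'
  obtain ⟨⟨φ, hφ⟩, -⟩ := mem_perSpace.1 hk.1
  obtain ⟨⟨φ', hφ'⟩, -⟩ := mem_perSpace.1 hk'.1
  obtain ⟨⟨ψ, hψ⟩, -⟩ := mem_perSpace.1 ((perSpace L).sub_mem hk.1 hk'.1)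
  have hp := pos_of_mem_admissible hG₀ hG
  have hfin := isFiniteMeasure_cell hG
  have hU := (hφ.represents hG₀ hG d hd).2
  have hU' := (hφ'.represents hG₀ hG d' hd').2
  have hsub : (fun z => pulledSolution L G G z - pulledSolution L G Ĝ z)
      =ᵐ[volume.restrict (cell L G)] fun z => toCell G ((k - k') 0) z + (d - d') := by
    refine ae_cell_of_ae_rect hG₀ hG ?_
    filter_upwards [hU.val, hU'.val, Lp.coeFn_sub (k 0) (k' 0)] with z e1 e2 e3
    rw [e1, e2, toCell_stretch hp, PiLp.sub_apply, e3, Pi.sub_apply]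
    ring
  have hW := (hψ.represents hG₀ hG (d - d') hsub).2
  have hmean : ∫ z in cell L G, (pulledSolution L G G z - pulledSolution L G Ĝ z) = 0 := by
    rw [integral_sub (hU.memH1.1.integrable (by norm_num)) (hU'.memH1.1.integrable (by norm_num))]
    simp only [pulledSolution]
    rw [integral_sub_average, integral_sub_average, sub_zero]
  refine ⟨⟨hU.memH1, hU'.memH1, ?_⟩, ?_⟩
  · refine (hW.h1Norm_le hG₀ hG hmean).trans ?_
    have := mul_le_mul_of_nonneg_left (hCk G hG Ĝ hĜ δ h0 h1 k k' hk hk') hK0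
    have : 0 ≤ D * δ := by positivity
    linarith
  · rw [hr.effCoeff_eq hL hG₀ hG, hr'.effCoeff_eq hL hG₀ hĜ, sub_sub_sub_cancel_left, abs_sub_comm]
    have := hDr G hG Ĝ hĜ δ h0 h1 k k' hk hk'
    have : 0 ≤ K * C * δ := by positivity
    linarith
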